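/- **Setting.** Let $\beta$ be a positive braid word on $N-n+1$ strands whose permutation fixes $k$, and let $\gamma$ be a positive braid word on $n$ strands. Strands are numbered from bottom to top and oriented from left to right; at each crossing of $\beta$ or $\gamma$ the descending strand is the overstrand. $\Lambda=\Lambda(\beta,k;\gamma)$ is the link whose Lagrangian projection is the blackboard-framed closure, around the figure-eight diagram of the unknot, of the $N$-stranded braid obtained from $\beta$ by replacing the $k$-th strand by $n$ parallel strands (the satellite strands) and inserting $\gamma$ (the purple box) on them at the right end of $\beta$. Its Reeb chords are: the chords $c_{ij}$, $1\le i,j\le N$, of degree $1$ (the $i$-th strand returning to the left over the $j$-th strand leaving the braid on the right), and, in degree $0$, the crossings of $\gamma$, one crossing for each crossing of $\beta$ not involving the $k$-th strand, and a group of $n$ crossings, ordered by the satellite strands from bottom to top, for each crossing of $\beta$ that involves the $k$-th strand. Base points are labelled by units of a commutative coefficient ring $R$ (e.g. by monomials $\pm s_i^{\pm1}$ in $\mathbb{Z}[s_1^{\pm1},\dots,s_q^{\pm1}]$); there may be arbitrarily many, provided that those on the satellite strands lie in the purple box and that none of the others lies between two crossings of the same group of $n$ crossings (in $\beta$ or among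 the $c_{ij}$). The algebra $\mathcal A_\Lambda$ is the unital tensor algebra over $R$ on the Reeb chords. **Elementary maps.** A Reidemeister III move at a triangle of strands $T$ over $M$ over $B$ is legal if each of the three strands meets its two crossings consecutively, in orders compatible with a planar triangle. If the Reeb signs of the corners of the triangle are $-$ at $TB$ and $+$ at $TM$ and $MB$, it induces $x_{TB}\mapsto x_{TB}+\sigma\,x_{TM}x_{MB}$, where $\sigma=\pm1$ is the product of the orientation signs of the quadrant at $TB$ opposite to the triangle and of the quadrants at $TM$ and $MB$ bounded by the side of the triangle leading to $TB$ and the ray of $M$ leaving the triangle; here the orientation sign is $-1$ for the quadrants to the right of the understrand at a positive crossing and $+1$ otherwise. All other chords are fixed. A base point labelled $s$ that moves through a crossing $x$ against the orientation induces $x\mapsto sx$ if it moves on the overstrand and $x\mapsto xs^{-1}$ if it moves on the understrand; all other chords are fixed. **The loop.** The purple-box loop $\vartheta$ pushes the purple box, against the orientation, through one strand after the other: from right to left through $\beta$, then on the returning strands through the $N$ leaving strands, then on the leaving strands through the $N$ returning strands, back to its initial place. Each passage through a strand is done by pushing the columns of base points and the crossings of the box one after the other, from left to right, by base point and Reidemeister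 III moves. The monodromy $\mathcal A(\vartheta):\mathcal A_\Lambda\to\mathcal A_\Lambda$ is the composition of the induced maps, the first move acting first, followed by the identification of the chords of the final diagram with the chords of the initial diagram in the same places. **Path matrix.** If the crossings $a_1,\dots,a_r$ of $\gamma$ occur at positions $k_1,\dots,k_r$ and the base points in the box have labels $\mathbf t_0,\dots,\mathbf t_r$ ($\mathbf t_\ell\in (R^\times)^n$, the label $1$ meaning no base point), put $P_\gamma=D(\mathbf t_0)P_{k_1}(a_1)D(\mathbf t_1)\cdots P_{k_r}(a_r)D(\mathbf t_r)$, where $D$ denotes diagonal matrices and $P_j(a)$ is the identity except for the block $\left(\begin{smallmatrix}0&1\\1&a\end{smallmatrix}\right)$ in rows and columns $j,j+1$. Let $\widetilde P_\gamma$ be the $N\times N$ matrix that is $P_\gamma$ in rows and columns $k,\dots,k+n-1$ and the identity elsewhere, and $C=(c_{ij})$. **Proposition.** All moves of $\vartheta$ are legal, and the final diagram is the initial one after the identification of chords. $P_\gamma$ and $\widetilde P_\gamma$ are invertible over $\mathcal A_\Lambda$, and: 1. $\mathcal A(\vartheta)(C)=\widetilde P_\gamma\, C\,\widetilde P_\gamma^{-1}$.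 2. $\mathcal A(\vartheta)$ fixes all crossings that do not involve the satellite strands, and all crossings of the purple box $\gamma$. 3. If $h_1,\dots,h_n$ is the group coming from a crossing of $\beta$ at which the $k$-th strand is the overstrand, then $\mathcal A(\vartheta)(h)=P_\gamma h$ for the column $h=(h_1,\dots,h_n)^T$. 4. If $h'_1,\dots,h'_n$ is the group coming from a crossing of $\beta$ at which the $k$-th strand is the understrand, then $\mathcal A(\vartheta)(h'_1,\dots,h'_n)=(h'_1,\dots,h'_n)\,P_\gamma^{-1}$ as row vectors over $\mathcal A_\Lambda$. In particular, after any homomorphism of $R$-algebras from $\mathcal A_\Lambda$ to a commutative $R$-algebra, the column $h'=(h_1',\dots,h_n')^T$ is transformed by left multiplication with $(P_\gamma^T)^{-1}$. -/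

import Mathlib

/-! ## Positive braid words and their path matrices

Strands are numbered from bottom to top, starting from `0`, and run from left to right. -/

/-- A positive braid word on `n` strands; its `ℓ`-th letter is the crossing of the strands in
positions `gen ℓ` and `gen ℓ + 1`. -/
structure PositiveBraid (n : ℕ) where
  len : ℕ
  gen : Fin len → Fin n
  gen_lt : ∀ ℓ, (gen ℓ : ℕ) + 1 < n

namespace PositiveBraid

variable {n : ℕ} (b : PositiveBraid n)

/-- Lower position at the `ℓ`-th crossing. -/
def lower (ℓ : Fin b.len) : Fin n := b.gen ℓ

/-- Upper position at the `ℓ`-th crossing. -/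
def upper (ℓ : Fin b.len) : Fin n := ⟨(b.gen ℓ : ℕ) + 1, b.gen_lt ℓ⟩

/-- `b.track ℓ i` is the position, after the first `ℓ` crossings, of the strand that enters the
braid from the left in position `i`. -/
def track : ℕ → Equiv.Perm (Fin n)
  | 0 => 1
  | ℓ + 1 => if h : ℓ < b.len then Equiv.swap (b.lower ⟨ℓ, h⟩) (b.upper ⟨ℓ, h⟩) * track ℓ
      else track ℓ

/-- The Coxeter projection of the braid: the strand entering at `i` leaves at `b.perm i`. -/
def perm : Equiv.Perm (Fin n) := b.track b.len

/-- The matrix `P_k(a)` of the `ℓ`-th crossing: the identity except for the block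
`(0 1; 1 a)` in the rows and columns of the two crossing positions. -/
def crossingMatrix {A : Type*} [Ring A] (ℓ : Fin b.len) (a : A) : Matrix (Fin n) (Fin n) A :=
  fun i j =>
    if i = b.lower ℓ then (if j = b.upper ℓ then 1 else 0)
    else if i = b.upper ℓ then (if j = b.lower ℓ then 1 else if j = b.upper ℓ then a else 0)
    else if i = j then 1 else 0

/-- The path matrix `D(t₀) P_{k₁}(a₁) D(t₁) ⋯ P_{k_r}(a_r) D(t_r)`, with a column of base points
before the first crossing and after each crossing. -/
def pathMatrix {A : Type*} [Ring A] (t : Fin (b.len + 1) → Fin n → A) (a : Fin b.len → A) :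
    Matrix (Fin n) (Fin n) A :=
  Matrix.diagonal (t 0) *
    (List.ofFn fun ℓ : Fin b.len =>
      b.crossingMatrix ℓ (a ℓ) * Matrix.diagonal (t ℓ.succ)).prod

end PositiveBraid

/-! ## Link diagrams with base points, elementary moves and their algebra maps

A Lagrangian projection, up to planar isotopy, is recorded by its oriented signed Gauss diagram:
one lists, along the oriented link, the passages through crossings (over or under) and through
base points, and records the sign of each crossing. -/

/-- The points met when traversing the link: the over- or undercrossing at `x`, or the base
point `b`. -/
inductive Passage (X B : Type*) where
  | over (x : X)
  | under (x : X)
  | pt (b : B)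

/-- A diagram with crossings (Reeb chords) `X` and base points `B` labelled by units of the
coefficient ring. -/
@[ext]
structure LinkDiagram (R : Type*) [CommRing R] (X B : Type*) where
  /-- `follows u v`: the passage `v` comes immediately after `u` along the oriented link. -/
  follows : Passage X B → Passage X B → Prop
  /-- The sign of a crossing: `1` for even, `-1` for odd degree of the Reeb chord. -/
  sign : X → ℤˣ
  label : B → Rˣ

/-- Elementary moves.

* `triple tm tb mb` is the Reidemeister III move at a triangle formed by a top strand `T`, a
  middle strand `M` and a bottom strand `B`, where `tm`, `tb`, `mb` are the crossings `T` over `M`,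
  `T` over `B`, `M` over `B`.
* `slide b x isOver back` moves the base point `b` through the crossing `x` along its over-
  (`isOver = true`) or understrand, against (`back = true`) or along the orientation. -/
inductive DiagramMove (X B : Type*) where
  | triple (tm tb mb : X)
  | slide (b : B) (x : X) (isOver back : Bool)

namespace LinkDiagram

variable {R : Type*} [CommRing R] {X B : Type*} (D : LinkDiagram R X B)

/-- `D.adj 1 u v`: `v` comes directly after `u`; `D.adj (-1) u v`: directly before. -/
def adj (e : ℤˣ) (u v : Passage X B) : Prop :=
  if e = 1 then D.follows u v else D.follows v u

open Classical in
/-- `1` if the top strand runs from `tb` to `tm`, and `-1` if it runs from `tm` to `tb`. -/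
noncomputable def dirTop (tm tb : X) : ℤˣ :=
  if D.follows (.over tb) (.over tm) then 1 else -1

/-- In a planar triangle with side vectors `α d_T` (from `tb` to `tm`), `μ d_M` (from `tm` to
`mb`) and `β d_B` (from `mb` to `tb`) along the oriented strands one has
`α d_T + μ d_M + β d_B = 0`. As the sign of a crossing is the sign of
`det (d_over, d_under)`, this determines the signs of `μ` and `β` from that of `α`.
Here: the sign of `μ`. -/
noncomputable def dirMiddle (tm tb mb : X) : ℤˣ :=
  -(D.dirTop tm tb * D.sign tb * D.sign mb)

/-- The sign of `β`; see `dirMiddle`. -/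
noncomputable def dirBottom (tm tb mb : X) : ℤˣ :=
  D.dirTop tm tb * D.sign tm * D.sign mb

/-- The orientation sign of a quadrant of the crossing `x`. The quadrant is bounded by a ray of the
overstrand, pointing along (`e = 1`) or against (`e = -1`) its orientation, and by a ray of the
understrand. At a positive crossing the two quadrants to the right of the understrand have
sign `-1` (these are the ones with `e = 1`); all other quadrants have sign `1`. -/
def quadrantSign (x : X) (e : ℤˣ) : ℤˣ :=
  if D.sign x = 1 then -e else 1

/-- The sign of the Reidemeister III map: the product of the orientation signs of three
quadrants. These are, at `tb`, the quadrant opposite to the triangle, and, at `tm` and at `mb`, the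
quadrant bounded by the side of the triangle leading to `tb` and by the ray of `M` that leaves
the triangle. -/
noncomputable def tripleSign (tm tb mb : X) : ℤˣ :=
  D.quadrantSign tb (-D.dirTop tm tb) * D.quadrantSign tm (-D.dirTop tm tb) *
    D.quadrantSign mb (D.dirMiddle tm tb mb)

/-- The legality of a move in the diagram `D`. -/
def LegalMove : DiagramMove X B → Prop
  | .triple tm tb mb =>
      tm ≠ tb ∧ tm ≠ mb ∧ tb ≠ mb ∧
      D.adj (D.dirTop tm tb) (.over tb) (.over tm) ∧
      D.adj (D.dirMiddle tm tb mb) (.under tm) (.over mb) ∧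
      D.adj (D.dirBottom tm tb mb) (.under mb) (.under tb)
  | .slide b x isOver back =>
      D.adj (if back then 1 else -1) (if isOver then .over x else .under x) (.pt b)

open Classical in
/-- The exchange of passages effected by a move: in a Reidemeister III move each of the three
strands meets its two crossings in the opposite order afterwards. -/
noncomputable def exchange (s : DiagramMove X B) : Equiv.Perm (Passage X B) :=
  match s with
  | .triple tm tb mb =>
      Equiv.swap (Passage.over tb) (Passage.over tm) *
        Equiv.swap (Passage.under tm) (Passage.over mb) *
        Equiv.swap (Passage.under mb) (Passage.under tb)
  | .slide b x isOver _ =>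
      Equiv.swap (if isOver then Passage.over x else Passage.under x) (Passage.pt b)

/-- The diagram after the move. -/
noncomputable def move (s : DiagramMove X B) : LinkDiagram R X B where
  follows u v := D.follows ((exchange s).symm u) ((exchange s).symm v)
  sign := D.sign
  label := D.label

open Classical in
/-- The algebra map `A_Λ → A_Λ'` of an elementary move from `Λ` to `Λ'`, where `A_Λ` is the unital
tensor algebra over the coefficient ring generated by the Reeb chords.

The Reidemeister III move is of type III_b (at the corners of the triangle the Reeb signs are
`-` at `tb` and `+` at `tm`, `mb`) if and only if the product of the three crossing signs is `1`;
otherwise it is of type III_a, with identity map. A base point with label `s` moving against the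
orientation through `x` gives `x ↦ s x` on the overstrand and `x ↦ x s⁻¹` on the understrand;
moving along the orientation gives the inverse map. -/
noncomputable def moveMap : DiagramMove X B → (FreeAlgebra R X →ₐ[R] FreeAlgebra R X)
  | .triple tm tb mb =>
      FreeAlgebra.lift R fun x =>
        if x = tb ∧ D.sign tm * D.sign tb * D.sign mb = 1 then
          FreeAlgebra.ι R tb +
            ((D.tripleSign tm tb mb : ℤˣ) : ℤ) • (FreeAlgebra.ι R tm * FreeAlgebra.ι R mb)
        else FreeAlgebra.ι R x
  | .slide b x isOver back =>
      FreeAlgebra.lift R fun y =>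
        if y = x then
          ((if isOver = back then D.label b else (D.label b)⁻¹ : Rˣ) : R) • FreeAlgebra.ι R x
        else FreeAlgebra.ι R y

/-- All moves of the sequence are legal. -/
def Legal : LinkDiagram R X B → List (DiagramMove X B) → Prop
  | _, [] => True
  | D, s :: l => D.LegalMove s ∧ Legal (D.move s) l

/-- The diagram at the end of a sequence of moves. -/
noncomputable def run : LinkDiagram R X B → List (DiagramMove X B) → LinkDiagram R X B
  | D, [] => D
  | D, s :: l => run (D.move s) l

/-- The composition of the algebra maps of a sequence of moves, the first move acting first. -/
noncomputable def inducedMap : LinkDiagram R X B → List (DiagramMove X B) →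
    (FreeAlgebra R X →ₐ[R] FreeAlgebra R X)
  | _, [] => AlgHom.id R _
  | D, s :: l => (inducedMap (D.move s) l).comp (D.moveMap s)

end LinkDiagram

/-- Renaming the crossings. -/
def Passage.rename {X B : Type*} (f : X → X) : Passage X B → Passage X B
  | .over x => .over (f x)
  | .under x => .under (f x)
  | .pt b => .pt b

/-- The diagram `D` in which the crossing `x` is called `e x`. -/
def LinkDiagram.relabel {R : Type*} [CommRing R] {X B : Type*} (D : LinkDiagram R X B)
    (e : Equiv.Perm X) : LinkDiagram R X B where
  follows u v := D.follows (u.rename e.symm) (v.rename e.symm)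
  sign x := D.sign (e.symm x)
  label := D.label

/-! ## The link `Λ(β, k; γ)` -/

/-- A positive braid word `β` on `m + 1` strands, a fixed point `k` of its permutation, and a
positive braid word `γ` on `n` strands, so that `Λ(β, k; γ)` has `N = m + n` braid strands. -/
structure SatelliteBraid (m n : ℕ) where
  β : PositiveBraid (m + 1)
  k : Fin (m + 1)
  fixed : β.perm k = k
  γ : PositiveBraid n

namespace SatelliteBraid

variable {m n : ℕ} (S : SatelliteBraid m n)

/-- Position of the satellited strand in `β` just before crossing `ℓ`. -/
def satPos (ℓ : Fin S.β.len) : Fin (m + 1) := S.β.track ℓ S.k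

/-- The crossing `ℓ` of `β` involves the satellited strand. -/
abbrev IsSat (ℓ : Fin S.β.len) : Prop :=
  S.satPos ℓ = S.β.lower ℓ ∨ S.satPos ℓ = S.β.upper ℓ

/-- The `N` braid strands, named by their positions at the left (or right) end of `β`: the strands
of `β` other than the `k`-th one, and the `n` strands replacing the `k`-th one. -/
abbrev Strand : Type := {i : Fin (m + 1) // i ≠ S.k} ⊕ Fin n

/-- The strands that replace the strand `i` of `β`, from bottom to top. -/
def block (i : Fin (m + 1)) : List S.Strand :=
  if h : i = S.k then (List.finRange n).map Sum.inr else [Sum.inl ⟨i, h⟩]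

/-- All strands, from bottom to top. -/
def strands : List S.Strand := (List.finRange (m + 1)).flatMap S.block

/-- The Reeb chords of `Λ(β, k; γ)`. -/
inductive Chord where
  /-- The chords `c_{ij}` of degree `1`: the `i`-th returning strand over the `j`-th strand leaving
  the braid on its right. -/
  | c (i j : S.Strand)
  /-- The crossings of `γ`. -/
  | box (ℓ : Fin S.γ.len)
  /-- The crossings of `β` not involving the satellited strand. -/
  | outer (ℓ : {ℓ : Fin S.β.len // ¬ S.IsSat ℓ})
  /-- The group of `n` crossings arising from a crossing of `β` with the satellited strand; the
  `q`-th one lies on the `q`-th satellite strand from the bottom. -/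
  | sat (ℓ : {ℓ : Fin S.β.len // S.IsSat ℓ}) (q : Fin n)

/-- The degrees of the Reeb chords. -/
def Chord.degree {S : SatelliteBraid m n} : S.Chord → ℕ
  | .c _ _ => 1
  | .box _ => 0
  | .outer _ => 0
  | .sat _ _ => 0

/-- The base points. There is one on each arc of the box containing `γ`, and, outside the
satellite sublink, one on each arc of the diagram that does not lie between two crossings of the
same group; absent base points are the ones labelled by `1`. -/
inductive BasePoint where
  /-- In column `ℓ` of the box, in position `q`. -/
  | box (ℓ : Fin (S.γ.len + 1)) (q : Fin n)
  /-- In column `ℓ` of `β`, in position `i`. -/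
  | outer (ℓ : Fin (S.β.len + 1)) (i : Fin (m + 1))
  /-- On strand `j` leaving `β` on its right, before it meets the returning block `i`. -/
  | leaving (j : {i : Fin (m + 1) // i ≠ S.k}) (i : Fin (m + 1))
  /-- On the returning strand `i`, before it meets the leaving block `j`. -/
  | returning (i : {i : Fin (m + 1) // i ≠ S.k}) (j : Fin (m + 1))

/-- Passages. -/
abbrev Pass : Type := Passage S.Chord S.BasePoint

/-- What a strand of `β` other than the satellited one meets at the crossing `ℓ` if it is in
position `p`. The descending strand is the overstrand. An ascending strand crosses the satellite
strands from bottom to top, a descending one from top to bottom. -/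
def outerCrossing (ℓ : Fin S.β.len) (p : Fin (m + 1)) : List S.Pass :=
  if p = S.β.lower ℓ then
    if h : S.IsSat ℓ then (List.finRange n).map fun q => .under (.sat ⟨ℓ, h⟩ q)
    else [.under (.outer ⟨ℓ, h⟩)]
  else if p = S.β.upper ℓ then
    if h : S.IsSat ℓ then (List.finRange n).reverse.map fun q => .over (.sat ⟨ℓ, h⟩ q)
    else [.over (.outer ⟨ℓ, h⟩)]
  else []

/-- The passages inside `β` of the strand that enters `β` in position `i`. -/
def outerBraid (i : {i : Fin (m + 1) // i ≠ S.k}) : List S.Pass :=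
  (List.finRange S.β.len).flatMap
      (fun ℓ : Fin S.β.len => .pt (.outer ℓ.castSucc (S.β.track ℓ i)) :: S.outerCrossing ℓ (S.β.track ℓ i)) ++
    [.pt (.outer (Fin.last _) (S.β.perm i))]

/-- The passages inside `β` of the `q`-th satellite strand. -/
def satBraid (q : Fin n) : List S.Pass :=
  (List.finRange S.β.len).flatMap fun ℓ =>
    if h : S.IsSat ℓ then
      if S.satPos ℓ = S.β.lower ℓ then [.under (.sat ⟨ℓ, h⟩ q)] else [.over (.sat ⟨ℓ, h⟩ q)]
    else []

/-- The passages inside the box of the strand that enters the box in position `q`. -/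
def boxBraid (q : Fin n) : List S.Pass :=
  (List.finRange S.γ.len).flatMap
      (fun ℓ : Fin S.γ.len => .pt (.box ℓ.castSucc (S.γ.track ℓ q)) ::
        (if S.γ.track ℓ q = S.γ.lower ℓ then [.under (.box ℓ)]
          else if S.γ.track ℓ q = S.γ.upper ℓ then [.over (.box ℓ)] else [])) ++
    [.pt (.box (Fin.last _) (S.γ.perm q))]

/-- The first passage through the square grid: the strand leaving the braid in position `j`
crosses under the returning strands, the top one first. -/
def leavingPass (j : S.Strand) : List S.Pass :=
  (List.finRange (m + 1)).reverse.flatMap fun i =>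
    (match j with
      | .inl j => [.pt (.leaving j i)]
      | .inr _ => []) ++
    (S.block i).reverse.map fun l => .under (.c l j)

/-- The second passage through the square grid: the returning strand `i` crosses over the leaving
strands, the bottom one first. -/
def returningPass (i : S.Strand) : List S.Pass :=
  (List.finRange (m + 1)).flatMap fun j =>
    (match i with
      | .inl i => [.pt (.returning i j)]
      | .inr _ => []) ++
    (S.block j).map fun l => .over (.c i l)

theorem perm_ne {i : Fin (m + 1)} (h : i ≠ S.k) : S.β.perm i ≠ S.k := fun h' =>
  h (S.β.perm.injective (h'.trans S.fixed.symm))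

/-- The position in which a strand leaves the braid. -/
def exit : S.Strand → S.Strand
  | .inl i => .inl ⟨S.β.perm i, S.perm_ne i.2⟩
  | .inr q => .inr (S.γ.perm q)

/-- The passages met when going once around the figure-eight unknot, starting at the left end of
the braid `β` and returning there in position `S.exit i`. The box with `γ` is to the right of
`β`. -/
def strandWord (i : S.Strand) : List S.Pass :=
  (match i with
    | .inl i => S.outerBraid i
    | .inr q => S.satBraid q ++ S.boxBraid q) ++
  S.leavingPass (S.exit i) ++ S.returningPass (S.exit i)

/-- The diagram of `Λ(β, k; γ)`, with base points labelled by `t`: the blackboard-framed satellite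
closure around the figure-eight diagram of the unknot. -/
def diagram {R : Type*} [CommRing R] (t : S.BasePoint → Rˣ) :
    LinkDiagram R S.Chord S.BasePoint where
  follows u v := ∃ i, [u, v] <:+: S.strandWord i ++ S.strandWord (S.exit i)
  sign x := (-1) ^ x.degree
  label := t

/-! ## The purple-box loop -/

/-- Push the box, against the orientation, through one strand. The `n` strands of the box pass over
(`isOver = true`) or under this strand, and `h q` is the crossing with the strand that enters the
box in position `q`. The columns of base points and the crossings of the box are pushed one after
the other, beginning at the left end of the box. -/
def pushBox (isOver : Bool) (h : Fin n → S.Chord) : List (DiagramMove S.Chord S.BasePoint) :=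
  let column (ℓ : Fin (S.γ.len + 1)) : List (DiagramMove S.Chord S.BasePoint) :=
    (List.finRange n).map fun q => .slide (.box ℓ q) (h ((S.γ.track ℓ).symm q)) isOver true
  (List.finRange S.γ.len).flatMap (fun ℓ : Fin S.γ.len =>
    let a : S.Chord := .box ℓ
    let hOver := h ((S.γ.track ℓ).symm (S.γ.upper ℓ))
    let hUnder := h ((S.γ.track ℓ).symm (S.γ.lower ℓ))
    column ℓ.castSucc ++
      [if isOver then .triple a hOver hUnder else .triple hOver hUnder a]) ++
  column (Fin.last _)

/-- Push the box through `β`, from right to left. -/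
def pushThroughBraid : List (DiagramMove S.Chord S.BasePoint) :=
  (List.finRange S.β.len).reverse.flatMap fun ℓ =>
    if h : S.IsSat ℓ then
      S.pushBox (decide (S.satPos ℓ = S.β.upper ℓ)) fun q => .sat ⟨ℓ, h⟩ q
    else []

/-- After a planar isotopy around the left end of the diagram, the box lies on the returning
strands; push it through the leaving strands. -/
def pushThroughReturning : List (DiagramMove S.Chord S.BasePoint) :=
  S.strands.reverse.flatMap fun j => S.pushBox true fun q => .c (.inr q) j

/-- The box lies now on the loop at the right end of the diagram; push it through the returning
strands, to the right end of `β`. As the box has passed through them, the returning satellite strand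
in position `p` carries the crossings that were in position `γ.perm⁻¹ p` at the beginning. -/
def pushThroughLeaving : List (DiagramMove S.Chord S.BasePoint) :=
  S.strands.flatMap fun i => S.pushBox false fun q => .c (i.map id S.γ.perm.symm) (.inr q)

/-- The purple-box loop `ϑ`, as a sequence of Reidemeister III and base point moves. -/
def purpleLoop : List (DiagramMove S.Chord S.BasePoint) :=
  S.pushThroughBraid ++ S.pushThroughReturning ++ S.pushThroughLeaving

/-- At the end of the loop the diagram agrees with the initial one, but the crossings on the
satellite strands have changed places according to the permutation of `γ`. This map sends a crossing
of the final diagram to the crossing of the initial diagram in the same place. -/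
def place (e : Equiv.Perm (Fin n)) : S.Chord → S.Chord
  | .c i j => .c (i.map id e) (j.map id e)
  | .box ℓ => .box ℓ
  | .outer ℓ => .outer ℓ
  | .sat ℓ q => .sat ℓ (e q)

/-- The identification of the Reeb chords of the final diagram with those of the initial one. -/
def identification : Equiv.Perm S.Chord where
  toFun := S.place S.γ.perm
  invFun := S.place S.γ.perm.symm
  left_inv x := by rcases x with ⟨_ | _, _ | _⟩ | _ | _ | _ <;> simp [place]
  right_inv x := by rcases x with ⟨_ | _, _ | _⟩ | _ | _ | _ <;> simp [place]

variable {R : Type*} [CommRing R] (t : S.BasePoint → Rˣ)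

/-- The underlying algebra of the Legendrian contact DGA: the unital tensor algebra over the
coefficient ring on the Reeb chords. -/
abbrev Alg (R : Type*) [CommRing R] : Type _ := FreeAlgebra R S.Chord

/-- The purple-box monodromy `A(ϑ)`. -/
noncomputable def monodromy : S.Alg R →ₐ[R] S.Alg R :=
  (FreeAlgebra.lift R fun x => FreeAlgebra.ι R (S.identification x)).comp
    ((S.diagram t).inducedMap S.purpleLoop)

/-- The path matrix `P_γ`. -/
noncomputable def boxMatrix : Matrix (Fin n) (Fin n) (S.Alg R) :=
  S.γ.pathMatrix (fun ℓ q => algebraMap R (S.Alg R) (t (.box ℓ q)))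
    (fun ℓ => FreeAlgebra.ι R (.box ℓ))

/-- The `N × N` matrix that is `P_γ` on the satellite strands and the identity elsewhere. -/
noncomputable def extendedBoxMatrix : Matrix S.Strand S.Strand (S.Alg R) :=
  Matrix.fromBlocks 1 0 0 (S.boxMatrix t)

/-- The matrix `C` of the degree `1` chords. -/
noncomputable def chordMatrix (R : Type*) [CommRing R] : Matrix S.Strand S.Strand (S.Alg R) :=
  fun i j => FreeAlgebra.ι R (.c i j)

/-- The column of the crossings in the group coming from the crossing `ℓ` of `β`. -/
noncomputable def group (R : Type*) [CommRing R] (ℓ : {ℓ : Fin S.β.len // S.IsSat ℓ}) :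
    Fin n → S.Alg R :=
  fun q => FreeAlgebra.ι R (.sat ℓ q)

end SatelliteBraid

/-
A legal Reidemeister III or base point move only exchanges passages that are adjacent on a strand,
so a sequence of legal moves transports a diagram along a permutation of its passages. Legality and
the final diagram are therefore a matter of following words of passages.

Pushing one column of base points or one crossing of the box through a strand multiplies the group
of `n` crossings of the box with this strand by the corresponding factor of the path matrix: from
the left if the box passes over, and by the inverse from the right if it passes under. A whole
passage thus turns a column `h` into `P_γ h`, or a row `h'` into `h' P_γ⁻¹`. In `C`, a passage over
the strands acts on rows and a passage under them on columns, which together give the conjugation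
`P̃ C P̃⁻¹`.
-/

theorem isChain_iff_forall_infix {α : Type*} {r : α → α → Prop} {l : List α} :
    l.IsChain r ↔ ∀ u v, [u, v] <:+: l → r u v := by
  rw [List.isChain_iff_forall_rel_of_append_cons_cons]
  constructor
  · rintro h u v ⟨l₁, l₂, rfl⟩
    exact h (l₁ := l₁) (l₂ := l₂) (by simp)
  · rintro h u v l₁ l₂ rfl
    exact h u v ⟨l₁, l₂, by simp⟩

theorem pair_infix_append_iff {α : Type*} {u v : α} {l₁ l₂ : List α} :
    [u, v] <:+: l₁ ++ l₂ ↔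
      [u, v] <:+: l₁ ∨ [u, v] <:+: l₂ ∨ u ∈ l₁.getLast? ∧ v ∈ l₂.head? := by
  have not_infix_iff (l : List α) :
      ¬ [u, v] <:+: l ↔ l.IsChain fun a b => ¬ (a = u ∧ b = v) := by
    rw [isChain_iff_forall_infix]
    exact ⟨fun h a b hab e => h (e.1 ▸ e.2 ▸ hab), fun h huv => h u v huv ⟨rfl, rfl⟩⟩
  rw [← not_iff_not]
  simp only [not_or, not_infix_iff, List.isChain_append]
  refine and_congr_right fun _ => and_congr_right fun _ => ⟨fun h hm => ?_, ?_⟩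
  · exact h u hm.1 v hm.2 ⟨rfl, rfl⟩
  · rintro h x hx y hy ⟨rfl, rfl⟩
    exact h ⟨hx, hy⟩

theorem pair_infix_append_append {α : Type*} {u v : α} {l₁ l₂ l₃ : List α} (hne : l₂ ≠ [])
    (h : [u, v] <:+: l₁ ++ (l₂ ++ l₃)) : [u, v] <:+: l₁ ++ l₂ ∨ [u, v] <:+: l₂ ++ l₃ := by
  rcases pair_infix_append_iff.1 h with h | h | ⟨hu, hv⟩
  · exact .inl (h.trans (List.prefix_append _ _).isInfix)
  · exact .inr h
  · refine .inl (pair_infix_append_iff.2 (.inr (.inr ⟨hu, ?_⟩)))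
    rwa [List.head?_append_of_ne_nil _ hne] at hv

theorem pair_infix_map_equiv {α β : Type*} (E : α ≃ β) (l : List α) (u v : β) :
    [u, v] <:+: l.map E ↔ [E.symm u, E.symm v] <:+: l := by
  constructor <;> intro h
  · simpa using h.map E.symm
  · simpa using h.map E

theorem pair_infix_finRange {n : ℕ} {q q' : Fin n} (hq : (q : ℕ) + 1 = q') :
    [q, q'] <:+: List.finRange n := by
  refine ⟨(List.finRange n).take q, (List.finRange n).drop (q + 2), ?_⟩
  have drop_eq : (List.finRange n).drop q = q :: q' :: (List.finRange n).drop (q + 2) := by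
    rw [List.drop_eq_getElem_cons (by simp), List.drop_eq_getElem_cons (by simp [hq])]
    simp only [List.getElem_finRange, Fin.cast_mk, Fin.eta, hq, List.cons.injEq,
      List.drop_eq_drop_iff, List.length_finRange, true_and]
    omega
  rw [List.append_assoc, List.cons_append, List.cons_append, List.nil_append, ← drop_eq,
    List.take_append_drop]

theorem map_eq_self_of_forall_mem {α : Type*} {f : α → α} {l : List α} (h : ∀ u ∈ l, f u = u) :
    l.map f = l := by
  simpa using List.map_congr_left (g := id) h

theorem finRange_split_induction {r : ℕ}
    {motive : Fin (r + 1) → List (Fin r) → List (Fin r) → Prop}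
    (start : motive 0 [] (List.finRange r))
    (step : ∀ ℓ L₁ L₂, (L₁ ++ ℓ :: L₂).Nodup → motive ℓ.castSucc L₁ (ℓ :: L₂) →
      motive ℓ.succ (L₁ ++ [ℓ]) L₂) :
    motive (Fin.last r) (List.finRange r) [] := by
  have prefix_case (c : Fin (r + 1)) :
      motive c ((List.finRange r).take c) ((List.finRange r).drop c) := by
    induction c using Fin.induction with
    | zero => exact start
    | succ ℓ ih =>
      have hℓ : (ℓ : ℕ) < (List.finRange r).length := by simp
      have hdrop := List.drop_eq_getElem_cons hℓ
      have htake := List.take_concat_get' (List.finRange r) ℓ hℓ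
      simp only [List.getElem_finRange, Fin.cast_mk, Fin.eta] at hdrop htake
      rw [Fin.val_castSucc, hdrop] at ih
      rw [Fin.val_succ, ← htake]
      refine step ℓ _ _ ?_ ih
      rw [← hdrop, List.take_append_drop]
      exact List.nodup_finRange r
  simpa [List.take_of_length_le, List.drop_of_length_le] using prefix_case (Fin.last r)

theorem prod_map_finRange_mul_last {M : Type*} [Monoid M] {r : ℕ} (f : Fin (r + 1) → M)
    (g : Fin r → M) :
    ((List.finRange r).map fun ℓ => f ℓ.castSucc * g ℓ).prod * f (Fin.last r) =
      f 0 * ((List.finRange r).map fun ℓ => g ℓ * f ℓ.succ).prod := by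
  refine finRange_split_induction (motive := fun c L _ =>
    (L.map fun ℓ => f ℓ.castSucc * g ℓ).prod * f c = f 0 * (L.map fun ℓ => g ℓ * f ℓ.succ).prod)
    (by simp) fun ℓ L₁ L₂ _ ih => ?_
  simp only [List.map_append, List.map_cons, List.map_nil, List.prod_append, List.prod_singleton,
    ← mul_assoc, ← ih]

/-! ### Moves of link diagrams -/

namespace Passage

variable {X B : Type*}

/-- The passage through the crossing `x` on its overstrand (`o = true`) or understrand. -/
def through (o : Bool) (x : X) : Passage X B := if o then .over x else .under x

theorem through_inj {o o' : Bool} {x y : X} :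
    (through o x : Passage X B) = through o' y ↔ o = o' ∧ x = y := by
  cases o <;> cases o' <;> simp [through]

theorem through_ne_pt {o : Bool} {x : X} {b : B} : (through o x : Passage X B) ≠ .pt b := by
  cases o <;> simp [through]

end Passage

namespace LinkDiagram

open Passage

variable {R : Type*} [CommRing R] {X B : Type*}

/-- The diagram `D` with the passage `E u` in the place of `u`. A sequence of moves has this effect,
`E` being the product of its exchanges. -/
def transport (D : LinkDiagram R X B) (E : Equiv.Perm (Passage X B)) : LinkDiagram R X B where
  follows u v := D.follows (E.symm u) (E.symm v)
  sign := D.sign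
  label := D.label

theorem transport_mul (D : LinkDiagram R X B) (E F : Equiv.Perm (Passage X B)) :
    D.transport (F * E) = (D.transport E).transport F := rfl

/-- The composite exchange of passages of a sequence of moves, the first move acting first. -/
noncomputable def totalExchange : List (DiagramMove X B) → Equiv.Perm (Passage X B)
  | [] => 1
  | s :: l => totalExchange l * exchange s

theorem totalExchange_append (l₁ l₂ : List (DiagramMove X B)) :
    totalExchange (l₁ ++ l₂) = totalExchange l₂ * totalExchange l₁ := by
  induction l₁ with
  | nil => simp [totalExchange]
  | cons s l ih => simp [totalExchange, ih, mul_assoc]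

theorem totalExchange_apply_of_forall_fixed {l : List (DiagramMove X B)} {u : Passage X B}
    (h : ∀ s ∈ l, exchange s u = u) : totalExchange l u = u := by
  induction l with
  | nil => rfl
  | cons s l ih =>
    rw [totalExchange, Equiv.Perm.mul_apply, h s (by simp), ih fun s' hs' => h s' (by simp [hs'])]

theorem run_eq_transport (D : LinkDiagram R X B) (l : List (DiagramMove X B)) :
    D.run l = D.transport (totalExchange l) := by
  induction l generalizing D with
  | nil => rfl
  | cons s l ih => rw [run, ih]; rfl

/-- All moves of the sequence are legal, and each move `s` induces the algebra map `φ s`, whatever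
the diagram in which it takes place. -/
def Realizes (φ : DiagramMove X B → (FreeAlgebra R X →ₐ[R] FreeAlgebra R X)) :
    LinkDiagram R X B → List (DiagramMove X B) → Prop
  | _, [] => True
  | D, s :: l => D.LegalMove s ∧ D.moveMap s = φ s ∧ Realizes φ (D.move s) l

/-- The composite of the algebra maps `φ s` of a sequence of moves, the first move acting first. -/
noncomputable def composite (φ : DiagramMove X B → (FreeAlgebra R X →ₐ[R] FreeAlgebra R X)) :
    List (DiagramMove X B) → (FreeAlgebra R X →ₐ[R] FreeAlgebra R X)
  | [] => AlgHom.id R _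
  | s :: l => (composite φ l).comp (φ s)

section Realizes

variable {φ : DiagramMove X B → (FreeAlgebra R X →ₐ[R] FreeAlgebra R X)} {D : LinkDiagram R X B}

theorem composite_append (l₁ l₂ : List (DiagramMove X B)) :
    composite φ (l₁ ++ l₂) = (composite φ l₂).comp (composite φ l₁) := by
  induction l₁ with
  | nil => rfl
  | cons s l ih => simp [composite, ih, AlgHom.comp_assoc]

theorem composite_apply_of_forall_fixed {l : List (DiagramMove X B)} {a : FreeAlgebra R X}
    (h : ∀ s ∈ l, φ s a = a) : composite φ l a = a := by
  induction l with
  | nil => rfl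
  | cons s l ih =>
    rw [composite, AlgHom.comp_apply, h s (by simp), ih fun s' hs' => h s' (by simp [hs'])]

theorem Realizes.legal {l : List (DiagramMove X B)} (h : D.Realizes φ l) : D.Legal l := by
  induction l generalizing D with
  | nil => trivial
  | cons s l ih => exact ⟨h.1, ih h.2.2⟩

theorem Realizes.inducedMap_eq {l : List (DiagramMove X B)} (h : D.Realizes φ l) :
    D.inducedMap l = composite φ l := by
  induction l generalizing D with
  | nil => rfl
  | cons s l ih => rw [inducedMap, composite, ih h.2.2, h.2.1]

theorem realizes_append {l₁ l₂ : List (DiagramMove X B)} :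
    D.Realizes φ (l₁ ++ l₂) ↔
      D.Realizes φ l₁ ∧ (D.transport (totalExchange l₁)).Realizes φ l₂ := by
  induction l₁ generalizing D with
  | nil => simp only [List.nil_append, Realizes, true_and]; rfl
  | cons s l ih => simp only [List.cons_append, Realizes, ih, and_assoc]; rfl

end Realizes

theorem isChain_transport {D : LinkDiagram R X B} {l : List (Passage X B)}
    (h : l.IsChain D.follows) (E : Equiv.Perm (Passage X B)) :
    (l.map E).IsChain (D.transport E).follows := by
  simpa [List.isChain_map, transport] using h

/-- The link is traversed along the words `W i`, the word `W i` being followed by `W (next i)`. -/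
def IsTraversal {ι : Type*} (D : LinkDiagram R X B) (W : ι → List (Passage X B))
    (next : ι → ι) : Prop :=
  ∀ u v, D.follows u v ↔ ∃ i, [u, v] <:+: W i ++ W (next i)

section IsTraversal

variable {ι : Type*} {D : LinkDiagram R X B} {W : ι → List (Passage X B)}

theorem IsTraversal.isChain {next : ι → ι} (h : D.IsTraversal W next) (i : ι) :
    (W i).IsChain D.follows :=
  isChain_iff_forall_infix.2 fun u v huv =>
    (h u v).2 ⟨i, huv.trans (List.prefix_append _ _).isInfix⟩

theorem IsTraversal.transport {next : ι → ι} (h : D.IsTraversal W next)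
    (E : Equiv.Perm (Passage X B)) :
    (D.transport E).IsTraversal (fun i => (W i).map E) next := fun u v => by
  simp only [← List.map_append, pair_infix_map_equiv]
  exact h _ _

theorem IsTraversal.rotate {V : ι → List (Passage X B)} {next : Equiv.Perm ι}
    (h : D.IsTraversal (fun i => V i ++ W i) next)
    (h₁ : ∀ i, V i ++ W i ≠ []) (h₂ : ∀ i, W i ++ V (next i) ≠ []) :
    D.IsTraversal (fun i => W i ++ V (next i)) next := by
  intro u v
  rw [h u v]
  constructor
  · rintro ⟨i, hi⟩
    obtain ⟨j, rfl⟩ := next.surjective i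
    have hi' : [u, v] <:+: V (next j) ++ (W (next j) ++ V (next (next j)) ++
        W (next (next j))) := by simpa using hi
    rcases pair_infix_append_append (h₂ _) hi' with hi | hi
    · exact ⟨j, hi.trans ⟨W j, [], by simp⟩⟩
    · exact ⟨next j, hi.trans ⟨[], V (next (next (next j))), by simp⟩⟩
  · rintro ⟨i, hi⟩
    have hi' : [u, v] <:+: W i ++ (V (next i) ++ W (next i) ++ V (next (next i))) := by
      simpa using hi
    rcases pair_infix_append_append (h₁ _) hi' with hi | hi
    · exact ⟨i, hi.trans ⟨V i, [], by simp⟩⟩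
    · exact ⟨next i, hi.trans ⟨[], W (next (next i)), by simp⟩⟩

end IsTraversal

open Classical in
/-- The endomorphism of the tensor algebra that replaces the generator `x` by `a`. -/
noncomputable def substitution (x : X) (a : FreeAlgebra R X) :
    FreeAlgebra R X →ₐ[R] FreeAlgebra R X :=
  FreeAlgebra.lift R (Function.update (FreeAlgebra.ι R) x a)

theorem substitution_ι_self (x : X) (a : FreeAlgebra R X) :
    substitution x a (FreeAlgebra.ι R x) = a := by
  simp [substitution]

theorem substitution_ι_of_ne {x y : X} (h : y ≠ x) (a : FreeAlgebra R X) :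
    substitution x a (FreeAlgebra.ι R y) = FreeAlgebra.ι R y := by
  simp [substitution, h]

theorem moveMap_slide (D : LinkDiagram R X B) (b : B) (x : X) (o back : Bool) :
    D.moveMap (.slide b x o back) = substitution x
      (((if o = back then D.label b else (D.label b)⁻¹ : Rˣ) : R) • FreeAlgebra.ι R x) := by
  classical
  refine congrArg (FreeAlgebra.lift R) (funext fun y => ?_)
  rw [Function.update_apply]

theorem moveMap_triple (D : LinkDiagram R X B) {tm tb mb : X}
    (h : D.sign tm * D.sign tb * D.sign mb = 1) :
    D.moveMap (.triple tm tb mb) = substitution tb (FreeAlgebra.ι R tb +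
      ((D.tripleSign tm tb mb : ℤˣ) : ℤ) • (FreeAlgebra.ι R tm * FreeAlgebra.ι R mb)) := by
  classical
  refine congrArg (FreeAlgebra.lift R) (funext fun y => ?_)
  rw [Function.update_apply]
  simp only [h, and_true]

section Slide

theorem exchange_slide_of_ne {b : B} {x : X} {o back : Bool} {u : Passage X B}
    (hx : u ≠ through o x) (hb : u ≠ .pt b) : exchange (.slide b x o back) u = u := by
  classical exact Equiv.swap_apply_of_ne_of_ne hx hb

variable {ι : Type*} {b : ι → B} {x : ι → X} {o back : Bool} {L : List ι}

theorem totalExchange_slides_of_ne {u : Passage X B}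
    (h : ∀ i ∈ L, u ≠ through o (x i) ∧ u ≠ .pt (b i)) :
    totalExchange (L.map fun i => .slide (b i) (x i) o back) u = u := by
  refine totalExchange_apply_of_forall_fixed fun s hs => ?_
  obtain ⟨i, hi, rfl⟩ := List.mem_map.1 hs
  exact exchange_slide_of_ne (h i hi).1 (h i hi).2

theorem totalExchange_slides_apply (hb : b.Injective) (hx : x.Injective) (hL : L.Nodup)
    {i : ι} (hi : i ∈ L) :
    totalExchange (L.map fun i => .slide (b i) (x i) o back) (through o (x i)) = .pt (b i) ∧
      totalExchange (L.map fun i => .slide (b i) (x i) o back) (.pt (b i)) = through o (x i) := by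
  classical
  induction L with
  | nil => simp at hi
  | cons j L ih =>
    obtain ⟨hj, hL⟩ := List.nodup_cons.1 hL
    simp only [List.map_cons, totalExchange, Equiv.Perm.mul_apply]
    rcases eq_or_ne i j with rfl | hij
    · have swap_left : exchange (.slide (b i) (x i) o back) (through o (x i)) = .pt (b i) :=
        Equiv.swap_apply_left _ _
      have swap_right : exchange (.slide (b i) (x i) o back) (.pt (b i)) = through o (x i) :=
        Equiv.swap_apply_right _ _
      have ne_of_mem : ∀ k ∈ L, i ≠ k := fun k hk e => hj (e ▸ hk)
      rw [swap_left, swap_right]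
      refine ⟨totalExchange_slides_of_ne fun k hk => ⟨through_ne_pt.symm, fun e => ?_⟩,
        totalExchange_slides_of_ne fun k hk => ⟨fun e => ?_, through_ne_pt⟩⟩
      · exact ne_of_mem k hk (hb (Passage.pt.inj e))
      · exact ne_of_mem k hk (hx (through_inj.1 e).2)
    · rw [exchange_slide_of_ne (fun e => hij (hx (through_inj.1 e).2)) through_ne_pt,
        exchange_slide_of_ne through_ne_pt.symm fun e => hij (hb (Passage.pt.inj e))]
      exact ih hL ((List.mem_cons.1 hi).resolve_left hij)

theorem realizes_slides {D : LinkDiagram R X B}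
    {φ : DiagramMove X B → (FreeAlgebra R X →ₐ[R] FreeAlgebra R X)}
    (hφ : ∀ i, D.moveMap (.slide (b i) (x i) o true) = φ (.slide (b i) (x i) o true))
    (hb : b.Injective) (hx : x.Injective) (hL : L.Nodup)
    (hD : ∀ i ∈ L, D.follows (through o (x i)) (.pt (b i))) :
    D.Realizes φ (L.map fun i => .slide (b i) (x i) o true) := by
  induction L generalizing D with
  | nil => trivial
  | cons j L ih =>
    obtain ⟨hj, hL⟩ := List.nodup_cons.1 hL
    refine ⟨by simpa [LegalMove, adj, through] using hD j (by simp), hφ j,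
      ih (D := D.move _) hφ hL fun i hi => ?_⟩
    have hij : i ≠ j := fun e => hj (e ▸ hi)
    have fixed_through : (exchange (.slide (b j) (x j) o true)).symm (through o (x i)) =
        through o (x i) :=
      (Equiv.symm_apply_eq _).2 (exchange_slide_of_ne
        (fun e => hij (hx (through_inj.1 e).2)) through_ne_pt).symm
    have fixed_pt : (exchange (.slide (b j) (x j) o true)).symm (Passage.pt (b i)) = .pt (b i) :=
      (Equiv.symm_apply_eq _).2 (exchange_slide_of_ne
        through_ne_pt.symm fun e => hij (hb (Passage.pt.inj e))).symm
    simp only [move, fixed_through, fixed_pt]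
    exact hD i (by simp [hi])

end Slide

section Triple

/-- The Reidemeister III move that pushes the crossing `a` across a strand `W`: both strands
at `a` pass over (`o = true`) or under `W`, the overstrand of `a` crossing `W` at `x` and the
understrand of `a` crossing `W` at `y`. -/
def crossingMove (o : Bool) (a x y : X) : DiagramMove X B :=
  if o then .triple a x y else .triple x y a

variable {a x y : X} {o : Bool}

open scoped Classical in
theorem exchange_crossingMove (hxy : x ≠ y) (hxa : x ≠ a) (hya : y ≠ a) :
    exchange (crossingMove o a x y : DiagramMove X B) =
      Equiv.swap (through o x) (.over a) * Equiv.swap (through o y) (.under a) *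
        Equiv.swap (through (!o) x) (through (!o) y) := by
  refine Equiv.ext fun u => ?_
  cases o <;>
    simp only [exchange, crossingMove, through, Equiv.Perm.mul_apply, Equiv.swap_apply_def, if_true,
      Bool.false_eq_true, if_false, Bool.not_true, Bool.not_false] <;> grind

theorem exchange_crossingMove_of_ne (hxy : x ≠ y) (hxa : x ≠ a) (hya : y ≠ a) {u : Passage X B}
    (hx : ∀ o', u ≠ through o' x) (hy : ∀ o', u ≠ through o' y) (ha : ∀ o', u ≠ through o' a) :
    exchange (crossingMove o a x y) u = u := by
  classical
  rw [exchange_crossingMove hxy hxa hya, Equiv.Perm.mul_apply, Equiv.Perm.mul_apply,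
    Equiv.swap_apply_of_ne_of_ne (hx (!o)) (hy (!o)),
    Equiv.swap_apply_of_ne_of_ne (hy o) (by exact ha false),
    Equiv.swap_apply_of_ne_of_ne (hx o) (by exact ha true)]

theorem exchange_crossingMove_apply (hxy : x ≠ y) (hxa : x ≠ a) (hya : y ≠ a) :
    let G : Equiv.Perm (Passage X B) := exchange (crossingMove o a x y)
    (G (through o x) = .over a ∧ G (.over a) = through o x) ∧
    (G (through o y) = .under a ∧ G (.under a) = through o y) ∧
    G (through (!o) x) = through (!o) y ∧ G (through (!o) y) = through (!o) x := by
  classical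
  intro G
  have hG : G = _ := exchange_crossingMove hxy hxa hya
  rw [hG]
  cases o <;> simp [through, Equiv.swap_apply_def, hxy, hxa, hya, hxa.symm, hya.symm, hxy.symm]

variable {D : LinkDiagram R X B} {s : ℤˣ}

/-- The situation in which `crossingMove o a x y` is possible: `a` is positive, `x` and `y` have the
sign `s`, and the strand that `a` is pushed across runs from `y` to `x` or from `x` to `y` depending
on `o` and `s`. -/
structure MovableCrossing (D : LinkDiagram R X B) (o : Bool) (a x y : X) (s : ℤˣ) : Prop where
  ne_xy : x ≠ y
  ne_xa : x ≠ a
  ne_ya : y ≠ a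
  sign_a : D.sign a = 1
  sign_x : D.sign x = s
  sign_y : D.sign y = s
  follows_over : D.follows (through o x) (.over a)
  follows_under : D.follows (through o y) (.under a)
  adj : D.adj (if o then s else -s) (through (!o) y) (through (!o) x)
  dirTop_eq : o = false → D.dirTop x y = -s

theorem MovableCrossing.legalMove (h : D.MovableCrossing o a x y s) :
    D.LegalMove (crossingMove o a x y) := by
  have ss := Int.units_mul_self s
  have adj_neg_one (u v : Passage X B) : D.adj (-1) u v ↔ D.follows v u := by
    simp [LinkDiagram.adj]
  have adj_one (u v : Passage X B) : D.adj 1 u v ↔ D.follows u v := by simp [LinkDiagram.adj]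
  have hadj := h.adj
  cases o
  · have dM : D.dirMiddle x y a = 1 := by
      simp [dirMiddle, h.dirTop_eq rfl, h.sign_y, h.sign_a, ss]
    have dB : D.dirBottom x y a = -1 := by
      simp [dirBottom, h.dirTop_eq rfl, h.sign_x, h.sign_a, ss]
    refine ⟨h.ne_xy, h.ne_xa, h.ne_ya, ?_, ?_, ?_⟩
    · rw [h.dirTop_eq rfl]
      exact hadj
    · rw [dM, adj_one]
      exact h.follows_over
    · rw [dB, adj_neg_one]
      exact h.follows_under
  · have dT : D.dirTop a x = 1 := if_pos h.follows_over
    have dM : D.dirMiddle a x y = -1 := by simp [dirMiddle, dT, h.sign_x, h.sign_y, ss]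
    have dB : D.dirBottom a x y = s := by simp [dirBottom, dT, h.sign_y, h.sign_a]
    refine ⟨h.ne_xa.symm, h.ne_ya.symm, h.ne_xy, ?_, ?_, ?_⟩
    · rw [dT, adj_one]
      exact h.follows_over
    · rw [dM, adj_neg_one]
      exact h.follows_under
    · rw [dB]
      exact hadj

theorem MovableCrossing.moveMap_over (h : D.MovableCrossing true a x y s) :
    D.moveMap (.triple a x y) =
      substitution x (FreeAlgebra.ι R x + FreeAlgebra.ι R a * FreeAlgebra.ι R y) := by
  have dT : D.dirTop a x = 1 := if_pos h.follows_over
  have hsign : D.tripleSign a x y = 1 := by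
    simp [tripleSign, quadrantSign, dirMiddle, dT, h.sign_x, h.sign_y, h.sign_a]
  rw [moveMap_triple D (by simp [h.sign_x, h.sign_y, h.sign_a]), hsign, Units.val_one, one_smul]

theorem MovableCrossing.moveMap_under (h : D.MovableCrossing false a x y s) :
    D.moveMap (.triple x y a) =
      substitution y (FreeAlgebra.ι R y - FreeAlgebra.ι R x * FreeAlgebra.ι R a) := by
  have dM : D.dirMiddle x y a = 1 := by
    simp [dirMiddle, h.dirTop_eq rfl, h.sign_y, h.sign_a]
  have hsign : D.tripleSign x y a = -1 := by
    simp only [tripleSign, quadrantSign, dM, h.dirTop_eq rfl, h.sign_x, h.sign_y, h.sign_a]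
    rw [Int.units_mul_self]
    simp
  rw [moveMap_triple D (by simp [h.sign_x, h.sign_y, h.sign_a]), hsign, Units.val_neg,
    Units.val_one, neg_smul, one_smul, sub_eq_add_neg]

end Triple

end LinkDiagram

/-! ### Pushing the box through strands -/

namespace PositiveBraid

variable {n : ℕ} (b : PositiveBraid n)

theorem lower_ne_upper (ℓ : Fin b.len) : b.lower ℓ ≠ b.upper ℓ := fun h => by
  simpa [lower, upper] using congrArg Fin.val h

theorem track_succ (ℓ : Fin b.len) :
    b.track (ℓ + 1) = Equiv.swap (b.lower ℓ) (b.upper ℓ) * b.track ℓ := by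
  rw [track, dif_pos ℓ.2]

end PositiveBraid

namespace LinkDiagram

variable {R : Type*} [CommRing R] {X B : Type*} {D : LinkDiagram R X B}

theorem adj_transport {E : Equiv.Perm (Passage X B)} {e : ℤˣ} {u v : Passage X B} :
    (D.transport E).adj e (E u) (E v) ↔ D.adj e u v := by
  simp [adj, transport]

theorem dirTop_transport {E : Equiv.Perm (Passage X B)} {tm tb tm' tb' : X}
    (hm : E (.over tm') = .over tm) (hb : E (.over tb') = .over tb) :
    (D.transport E).dirTop tm tb = D.dirTop tm' tb' := by
  rw [← Equiv.eq_symm_apply] at hm hb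
  classical exact if_congr (by simp only [transport, hm, hb]) rfl rfl

end LinkDiagram

namespace SatelliteBraid

open Passage LinkDiagram

variable {m n : ℕ} (S : SatelliteBraid m n)

/-- The passages of the box. -/
def IsBoxPass (u : S.Pass) : Prop :=
  (∃ o ℓ, u = through o (.box ℓ)) ∨ ∃ c p, u = .pt (.box c p)

/-- What the strand entering the box in position `q` meets at the crossing `ℓ` of the box. -/
def boxCrossing (ℓ : Fin S.γ.len) (q : Fin n) : List S.Pass :=
  if S.γ.track ℓ q = S.γ.lower ℓ then [.under (.box ℓ)]
  else if S.γ.track ℓ q = S.γ.upper ℓ then [.over (.box ℓ)] else []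

/-- What the strand entering the box in position `q` meets in column `c` of base points. -/
def boxColumn (c : Fin (S.γ.len + 1)) (q : Fin n) : List S.Pass :=
  [.pt (.box c (S.γ.track c q))]

/-- The crossings with the strand being pushed across, by the position of the box strand in column
`c`. -/
def crossingAt (h : Fin n → S.Chord) (c : Fin (S.γ.len + 1)) (p : Fin n) : S.Chord :=
  h ((S.γ.track c).symm p)

/-- The moves pushing column `c` of base points through a strand. -/
def pushColumn (o : Bool) (h : Fin n → S.Chord) (c : Fin (S.γ.len + 1)) :
    List (DiagramMove S.Chord S.BasePoint) :=
  (List.finRange n).map fun p => .slide (.box c p) (S.crossingAt h c p) o true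

/-- The move pushing the crossing `ℓ` of the box through a strand. -/
def pushCrossing (o : Bool) (h : Fin n → S.Chord) (ℓ : Fin S.γ.len) :
    DiagramMove S.Chord S.BasePoint :=
  crossingMove o (.box ℓ) (S.crossingAt h ℓ.castSucc (S.γ.upper ℓ))
    (S.crossingAt h ℓ.castSucc (S.γ.lower ℓ))

variable {S} {o : Bool} {h : Fin n → S.Chord}

theorem boxBraid_eq (q : Fin n) :
    S.boxBraid q = (List.finRange S.γ.len).flatMap
      (fun ℓ => S.boxColumn ℓ.castSucc q ++ S.boxCrossing ℓ q) ++ S.boxColumn (Fin.last _) q :=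
  rfl

theorem pushBox_eq :
    S.pushBox o h = (List.finRange S.γ.len).flatMap
      (fun ℓ => S.pushColumn o h ℓ.castSucc ++ [S.pushCrossing o h ℓ]) ++
        S.pushColumn o h (Fin.last _) :=
  rfl

theorem crossingAt_succ (ℓ : Fin S.γ.len) (p : Fin n) :
    S.crossingAt h ℓ.succ p =
      S.crossingAt h ℓ.castSucc (Equiv.swap (S.γ.lower ℓ) (S.γ.upper ℓ) p) := by
  simp only [crossingAt, Fin.val_succ, S.γ.track_succ]
  rfl

theorem isBoxPass_of_mem_boxCrossing {ℓ : Fin S.γ.len} {q : Fin n} {u : S.Pass}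
    (hu : u ∈ S.boxCrossing ℓ q) : ∃ o, u = through o (.box ℓ) := by
  unfold boxCrossing at hu
  split_ifs at hu
  · exact ⟨false, List.mem_singleton.1 hu⟩
  · exact ⟨true, List.mem_singleton.1 hu⟩
  · simp at hu

theorem isBoxPass_of_mem_boxBraid {q : Fin n} {u : S.Pass} (hu : u ∈ S.boxBraid q) :
    S.IsBoxPass u := by
  simp only [boxBraid_eq, List.mem_append, List.mem_flatMap, boxColumn, List.mem_singleton] at hu
  rcases hu with ⟨ℓ, -, rfl | hu⟩ | rfl
  · exact .inr ⟨_, _, rfl⟩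
  · obtain ⟨o, rfl⟩ := isBoxPass_of_mem_boxCrossing hu
    exact .inl ⟨_, _, rfl⟩
  · exact .inr ⟨_, _, rfl⟩

section Exchange

theorem totalExchange_pushColumn_of_ne {c : Fin (S.γ.len + 1)} {u : S.Pass}
    (hb : ∀ p, u ≠ .pt (.box c p)) (hu : ∀ q, u ≠ through o (h q)) :
    totalExchange (S.pushColumn o h c) u = u :=
  totalExchange_slides_of_ne fun _ _ => ⟨hu _, hb _⟩

theorem totalExchange_pushColumn_apply (hh : h.Injective) (c : Fin (S.γ.len + 1)) (q : Fin n) :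
    (through o (h q) :: S.boxColumn c q).map (totalExchange (S.pushColumn o h c)) =
      S.boxColumn c q ++ [through o (h q)] := by
  have hx := totalExchange_slides_apply (b := fun p => BasePoint.box c p)
    (x := S.crossingAt h c) (o := o) (back := true) (fun p p' e => by simpa using e)
    (hh.comp (S.γ.track c).symm.injective) (List.nodup_finRange n)
    (List.mem_finRange (S.γ.track c q))
  rw [crossingAt, Equiv.symm_apply_apply] at hx
  simp only [boxColumn, List.map_cons, List.map_nil, List.singleton_append, pushColumn]
  rw [hx.1, hx.2]

variable (hh : h.Injective) (hbox : ∀ q ℓ, h q ≠ .box ℓ)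

include hh in
theorem crossingAt_ne (ℓ : Fin S.γ.len) : S.crossingAt h ℓ.castSucc (S.γ.upper ℓ) ≠
    S.crossingAt h ℓ.castSucc (S.γ.lower ℓ) := fun e =>
  S.γ.lower_ne_upper ℓ ((S.γ.track _).symm.injective (hh e)).symm

include hh hbox

theorem exchange_pushCrossing_of_ne {ℓ : Fin S.γ.len} {u : S.Pass}
    (hb : ∀ o', u ≠ through o' (.box ℓ)) (hu : ∀ o' q, u ≠ through o' (h q)) :
    exchange (S.pushCrossing o h ℓ) u = u :=
  exchange_crossingMove_of_ne (crossingAt_ne hh ℓ) (hbox _ _) (hbox _ _)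
    (fun _ => hu _ _) (fun _ => hu _ _) hb

theorem exchange_pushCrossing_apply (ℓ : Fin S.γ.len) (q : Fin n) :
    (through o (h q) :: S.boxCrossing ℓ q).map (exchange (S.pushCrossing o h ℓ)) =
      S.boxCrossing ℓ q ++ [through o (h q)] := by
  obtain ⟨⟨over₁, over₂⟩, ⟨under₁, under₂⟩, -⟩ := exchange_crossingMove_apply
    (B := S.BasePoint) (o := o) (crossingAt_ne hh ℓ) (hbox _ ℓ) (hbox _ ℓ)
  obtain ⟨p, rfl⟩ := (S.γ.track ℓ).symm.surjective q
  simp only [boxCrossing, Equiv.apply_symm_apply]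
  split_ifs with hlower hupper
  · subst hlower
    simpa [pushCrossing, crossingAt] using And.intro under₁ under₂
  · subst hupper
    simpa [pushCrossing, crossingAt] using And.intro over₁ over₂
  · have ne_through (p' : Fin n) (hp : p ≠ p') (o' : Bool) :
        (through o (h ((S.γ.track ℓ).symm p)) : S.Pass) ≠
          through o' (S.crossingAt h ℓ.castSucc p') :=
      fun e => hp ((S.γ.track ℓ).symm.injective (hh (through_inj.1 e).2))
    simp only [List.map_cons, List.map_nil, List.nil_append]
    rw [pushCrossing, exchange_crossingMove_of_ne (crossingAt_ne hh ℓ) (hbox _ _) (hbox _ _)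
      (ne_through _ hupper) (ne_through _ hlower) fun _ e => hbox _ _ (through_inj.1 e).2]

theorem exchange_pushCrossing_opposite (ℓ : Fin S.γ.len) (p : Fin n) :
    exchange (S.pushCrossing o h ℓ) (through (!o) (S.crossingAt h ℓ.castSucc p)) =
      through (!o) (S.crossingAt h ℓ.succ p) := by
  obtain ⟨-, -, opp₁, opp₂⟩ := exchange_crossingMove_apply
    (B := S.BasePoint) (o := o) (crossingAt_ne hh ℓ) (hbox _ ℓ) (hbox _ ℓ)
  rw [crossingAt_succ]
  by_cases hlower : p = S.γ.lower ℓ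
  · rw [hlower, Equiv.swap_apply_left]
    exact opp₂
  by_cases hupper : p = S.γ.upper ℓ
  · rw [hupper, Equiv.swap_apply_right]
    exact opp₁
  have ne_through (p' : Fin n) (hp : p ≠ p') (o' : Bool) :
      (through (!o) (S.crossingAt h ℓ.castSucc p) : S.Pass) ≠
        through o' (S.crossingAt h ℓ.castSucc p') :=
    fun e => hp ((S.γ.track _).symm.injective (hh (through_inj.1 e).2))
  rw [Equiv.swap_apply_of_ne_of_ne hlower hupper, pushCrossing, exchange_crossingMove_of_ne
    (crossingAt_ne hh ℓ) (hbox _ _) (hbox _ _) (ne_through _ hupper) (ne_through _ hlower)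
    fun _ e => hbox _ _ (through_inj.1 e).2]

end Exchange

section Push

variable (S) in
/-- The situation in the middle of pushing the box, with the passages exchanged by `E`: the box
strand `q` has already met `pre q` and will meet `suf q` behind the strand `W` being pushed across,
and `W` meets the box strands in the order they have in column `c`. -/
structure PushState (o : Bool) (h : Fin n → S.Chord) (E : Equiv.Perm S.Pass)
    (c : Fin (S.γ.len + 1)) (pre suf : Fin n → List S.Pass) : Prop where
  word (q : Fin n) :
    (through o (h q) :: S.boxBraid q).map E = pre q ++ through o (h q) :: suf q
  opposite (p : Fin n) : E (through (!o) (h p)) = through (!o) (S.crossingAt h c p)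

theorem PushState.step {E G : Equiv.Perm S.Pass} {c c' : Fin (S.γ.len + 1)}
    {pre mid suf : Fin n → List S.Pass} (hE : S.PushState o h E c pre fun q => mid q ++ suf q)
    (hpre : ∀ q, ∀ u ∈ pre q, G u = u) (hsuf : ∀ q, ∀ u ∈ suf q, G u = u)
    (hmid : ∀ q, (through o (h q) :: mid q).map G = mid q ++ [through o (h q)])
    (hopp : ∀ p, G (through (!o) (S.crossingAt h c p)) = through (!o) (S.crossingAt h c' p)) :
    S.PushState o h (G * E) c' (fun q => pre q ++ mid q) suf where
  word q := by
    rw [Equiv.Perm.coe_mul, ← List.map_map, hE.word q, List.map_append, ← List.cons_append,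
      List.map_append, map_eq_self_of_forall_mem (hpre q), hmid q,
      map_eq_self_of_forall_mem (hsuf q)]
    simp
  opposite p := by rw [Equiv.Perm.mul_apply, hE.opposite, hopp]

theorem ne_through_of_isBoxPass {u : S.Pass} (hu : S.IsBoxPass u) {x : S.Chord}
    (hx : ∀ ℓ, x ≠ .box ℓ) (o' : Bool) : u ≠ through o' x := by
  rcases hu with ⟨o₁, ℓ, rfl⟩ | ⟨c, p, rfl⟩
  · exact fun e => hx ℓ (through_inj.1 e).2.symm
  · exact through_ne_pt.symm

/-- The passages met by the strand `q` at the letters `L` of the box. -/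
def boxLetters (L : List (Fin S.γ.len)) (q : Fin n) : List S.Pass :=
  L.flatMap fun ℓ => S.boxColumn ℓ.castSucc q ++ S.boxCrossing ℓ q

variable {E : Equiv.Perm S.Pass} {c : Fin (S.γ.len + 1)} {ℓ : Fin S.γ.len}
  {L L₁ L₂ : List (Fin S.γ.len)} {pre suf : Fin n → List S.Pass}

theorem isBoxPass_of_mem_boxLetters {q : Fin n} {u : S.Pass} (hu : u ∈ boxLetters L q) :
    S.IsBoxPass u := by
  obtain ⟨ℓ, -, hu⟩ := List.mem_flatMap.1 hu
  rcases List.mem_append.1 hu with hu | hu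
  · exact .inr ⟨_, _, List.mem_singleton.1 hu⟩
  · obtain ⟨o, rfl⟩ := isBoxPass_of_mem_boxCrossing hu
    exact .inl ⟨_, _, rfl⟩

theorem pt_notMem_boxLetters {q p : Fin n} (hc : ∀ ℓ ∈ L, ℓ.castSucc ≠ c) :
    .pt (.box c p) ∉ boxLetters L q := fun hu => by
  obtain ⟨ℓ, hℓ, hu⟩ := List.mem_flatMap.1 hu
  rcases List.mem_append.1 hu with hu | hu
  · have e := List.mem_singleton.1 hu
    simp only [Passage.pt.injEq, BasePoint.box.injEq] at e
    exact hc ℓ hℓ e.1.symm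
  · obtain ⟨o, e⟩ := isBoxPass_of_mem_boxCrossing hu
    exact through_ne_pt e.symm

theorem through_notMem_boxLetters {q : Fin n} (hL : ℓ ∉ L) :
    through o (.box ℓ) ∉ boxLetters L q := fun hu => by
  obtain ⟨ℓ', hℓ, hu⟩ := List.mem_flatMap.1 hu
  rcases List.mem_append.1 hu with hu | hu
  · exact through_ne_pt (List.mem_singleton.1 hu)
  · obtain ⟨o, e⟩ := isBoxPass_of_mem_boxCrossing hu
    rw [through_inj, Chord.box.injEq] at e
    exact hL (e.2 ▸ hℓ)

theorem PushState.pushColumn (hh : h.Injective) (hbox : ∀ q ℓ, h q ≠ .box ℓ)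
    (hE : S.PushState o h E c pre fun q => S.boxColumn c q ++ suf q)
    (hpass : ∀ q, ∀ u ∈ pre q ++ suf q, S.IsBoxPass u)
    (hpt : ∀ q p, .pt (.box c p) ∉ pre q ++ suf q) :
    S.PushState o h (totalExchange (S.pushColumn o h c) * E) c
      (fun q => pre q ++ S.boxColumn c q) suf := by
  have fixed (q : Fin n) (u : S.Pass) (hu : u ∈ pre q ++ suf q) :
      totalExchange (S.pushColumn o h c) u = u :=
    totalExchange_pushColumn_of_ne (fun p e => hpt q p (e ▸ hu)) fun q' =>
      ne_through_of_isBoxPass (hpass q u hu) (hbox q') o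
  exact hE.step (fun q u hu => fixed q u (by simp [hu])) (fun q u hu => fixed q u (by simp [hu]))
    (totalExchange_pushColumn_apply hh c) fun p =>
    totalExchange_pushColumn_of_ne (fun _ => through_ne_pt)
      fun q e => by cases o <;> simpa using (through_inj.1 e).1

theorem PushState.pushCrossing (hh : h.Injective) (hbox : ∀ q ℓ, h q ≠ .box ℓ)
    (hE : S.PushState o h E ℓ.castSucc pre fun q => S.boxCrossing ℓ q ++ suf q)
    (hpass : ∀ q, ∀ u ∈ pre q ++ suf q, S.IsBoxPass u)
    (hthrough : ∀ q o', through o' (.box ℓ) ∉ pre q ++ suf q) :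
    S.PushState o h (exchange (S.pushCrossing o h ℓ) * E) ℓ.succ
      (fun q => pre q ++ S.boxCrossing ℓ q) suf := by
  have fixed (q : Fin n) (u : S.Pass) (hu : u ∈ pre q ++ suf q) :
      exchange (S.pushCrossing o h ℓ) u = u :=
    exchange_pushCrossing_of_ne hh hbox (fun o' e => hthrough q o' (e ▸ hu)) fun o' q' =>
      ne_through_of_isBoxPass (hpass q u hu) (hbox q') o'
  exact hE.step (fun q u hu => fixed q u (by simp [hu])) (fun q u hu => fixed q u (by simp [hu]))
    (exchange_pushCrossing_apply hh hbox ℓ) (exchange_pushCrossing_opposite hh hbox ℓ)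

variable (S) in
/-- The moves pushing the letters `L` of the box, each preceded by its column, through a strand. -/
def pushLetters (o : Bool) (h : Fin n → S.Chord) (L : List (Fin S.γ.len)) :
    List (DiagramMove S.Chord S.BasePoint) :=
  L.flatMap fun ℓ => S.pushColumn o h ℓ.castSucc ++ [S.pushCrossing o h ℓ]

/-- The state between two letters of the box. -/
abbrev LetterState (o : Bool) (h : Fin n → S.Chord) (E : Equiv.Perm S.Pass)
    (c : Fin (S.γ.len + 1)) (L₁ L₂ : List (Fin S.γ.len)) : Prop :=
  S.PushState o h E c (boxLetters L₁) fun q => boxLetters L₂ q ++ S.boxColumn (Fin.last _) q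

theorem LetterState.of_cons (hE : LetterState o h E c L₁ (ℓ :: L₂)) :
    S.PushState o h E c (boxLetters L₁) fun q => S.boxColumn ℓ.castSucc q ++
      (S.boxCrossing ℓ q ++ (boxLetters L₂ q ++ S.boxColumn (Fin.last _) q)) := by
  simpa [LetterState, boxLetters] using hE

theorem LetterState.of_nil (hE : LetterState o h E c L []) :
    S.PushState o h E c (boxLetters L) fun q => S.boxColumn (Fin.last _) q ++ [] := by
  simpa [LetterState, boxLetters] using hE

theorem LetterState.pushColumn (hh : h.Injective) (hbox : ∀ q ℓ, h q ≠ .box ℓ)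
    (hL : (L₁ ++ ℓ :: L₂).Nodup) (hE : LetterState o h E ℓ.castSucc L₁ (ℓ :: L₂)) :
    S.PushState o h (totalExchange (S.pushColumn o h ℓ.castSucc) * E) ℓ.castSucc
      (fun q => boxLetters L₁ q ++ S.boxColumn ℓ.castSucc q)
      (fun q => S.boxCrossing ℓ q ++ (boxLetters L₂ q ++ S.boxColumn (Fin.last _) q)) := by
  rw [List.nodup_middle, List.nodup_cons, List.mem_append] at hL
  refine hE.of_cons.pushColumn hh hbox (fun q u hu => ?_) fun q p hu => ?_
  · simp only [List.mem_append] at hu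
    rcases hu with hu | hu | hu | hu
    · exact isBoxPass_of_mem_boxLetters hu
    · obtain ⟨o', rfl⟩ := isBoxPass_of_mem_boxCrossing hu
      exact .inl ⟨_, _, rfl⟩
    · exact isBoxPass_of_mem_boxLetters hu
    · exact .inr ⟨_, _, List.mem_singleton.1 hu⟩
  · simp only [List.mem_append] at hu
    have ne_castSucc (ℓ' : Fin S.γ.len) (hℓ : ℓ' ∈ L₁ ++ L₂) : ℓ'.castSucc ≠ ℓ.castSucc :=
      fun e => hL.1 (List.mem_append.1 (Fin.castSucc_injective _ e ▸ hℓ))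
    rcases hu with hu | hu | hu | hu
    · exact pt_notMem_boxLetters (fun ℓ' hℓ => ne_castSucc ℓ' (by simp [hℓ])) hu
    · obtain ⟨o', e⟩ := isBoxPass_of_mem_boxCrossing hu
      exact through_ne_pt e.symm
    · exact pt_notMem_boxLetters (fun ℓ' hℓ => ne_castSucc ℓ' (by simp [hℓ])) hu
    · have e := List.mem_singleton.1 hu
      simp only [Passage.pt.injEq, BasePoint.box.injEq] at e
      exact ℓ.castSucc_ne_last e.1

theorem LetterState.pushLetter (hh : h.Injective) (hbox : ∀ q ℓ, h q ≠ .box ℓ)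
    (hL : (L₁ ++ ℓ :: L₂).Nodup) (hE : LetterState o h E ℓ.castSucc L₁ (ℓ :: L₂)) :
    LetterState o h (exchange (S.pushCrossing o h ℓ) *
      (totalExchange (S.pushColumn o h ℓ.castSucc) * E)) ℓ.succ (L₁ ++ [ℓ]) L₂ := by
  have hE' := (hE.pushColumn hh hbox hL).pushCrossing hh hbox (fun q u hu => ?_)
    fun q o' hu => ?_
  · have hpre : boxLetters (L₁ ++ [ℓ]) = fun q =>
        boxLetters L₁ q ++ S.boxColumn ℓ.castSucc q ++ S.boxCrossing ℓ q :=
      funext fun q => by simp [boxLetters]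
    rwa [LetterState, hpre]
  · simp only [List.mem_append] at hu
    rcases hu with (hu | hu) | hu | hu
    · exact isBoxPass_of_mem_boxLetters hu
    · exact .inr ⟨_, _, List.mem_singleton.1 hu⟩
    · exact isBoxPass_of_mem_boxLetters hu
    · exact .inr ⟨_, _, List.mem_singleton.1 hu⟩
  · rw [List.nodup_middle, List.nodup_cons, List.mem_append, not_or] at hL
    simp only [List.mem_append] at hu
    rcases hu with (hu | hu) | hu | hu
    · exact through_notMem_boxLetters hL.1.1 hu
    · exact through_ne_pt (List.mem_singleton.1 hu)
    · exact through_notMem_boxLetters hL.1.2 hu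
    · exact through_ne_pt (List.mem_singleton.1 hu)

theorem letterState_start : LetterState o h 1 0 [] (List.finRange S.γ.len) where
  word _ := by simp [boxLetters, boxBraid_eq]
  opposite _ := rfl

theorem totalExchange_pushLetters_append (L : List (Fin S.γ.len)) (ℓ : Fin S.γ.len) :
    totalExchange (S.pushLetters o h (L ++ [ℓ])) = exchange (S.pushCrossing o h ℓ) *
      (totalExchange (S.pushColumn o h ℓ.castSucc) * totalExchange (S.pushLetters o h L)) := by
  simp [pushLetters, totalExchange_append, totalExchange, mul_assoc]

theorem letterState_finish (hh : h.Injective) (hbox : ∀ q ℓ, h q ≠ .box ℓ) :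
    LetterState o h (totalExchange (S.pushLetters o h (List.finRange S.γ.len)))
      (Fin.last _) (List.finRange _) [] := by
  refine finRange_split_induction (motive := fun c L₁ L₂ =>
    LetterState o h (totalExchange (S.pushLetters o h L₁)) c L₁ L₂) letterState_start
    fun ℓ L₁ L₂ hL hE => ?_
  rw [totalExchange_pushLetters_append]
  exact hE.pushLetter hh hbox hL

theorem pushState_pushBox (hh : h.Injective) (hbox : ∀ q ℓ, h q ≠ .box ℓ) :
    S.PushState o h (totalExchange (S.pushBox o h)) (Fin.last _) S.boxBraid fun _ => [] := by
  rw [pushBox_eq, totalExchange_append]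
  refine (letterState_finish hh hbox).of_nil.pushColumn hh hbox (fun q u hu => ?_) fun q p hu => ?_
  · exact isBoxPass_of_mem_boxLetters ((List.append_nil _).subst hu)
  · exact pt_notMem_boxLetters (fun ℓ _ => ℓ.castSucc_ne_last) ((List.append_nil _).subst hu)

theorem totalExchange_pushBox_of_ne (hh : h.Injective) (hbox : ∀ q ℓ, h q ≠ .box ℓ) {u : S.Pass}
    (hu : ¬ S.IsBoxPass u) (hu' : ∀ o' q, u ≠ through o' (h q)) :
    totalExchange (S.pushBox o h) u = u := by
  have column (c : Fin (S.γ.len + 1)) (s : DiagramMove S.Chord S.BasePoint)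
      (hs : s ∈ S.pushColumn o h c) : exchange s u = u := by
    obtain ⟨p, -, rfl⟩ := List.mem_map.1 hs
    exact exchange_slide_of_ne (hu' _ _) fun e => hu (.inr ⟨_, _, e⟩)
  refine totalExchange_apply_of_forall_fixed fun s hs => ?_
  simp only [pushBox_eq, List.mem_append, List.mem_flatMap, List.mem_singleton] at hs
  rcases hs with ⟨ℓ, -, hs | rfl⟩ | hs
  · exact column _ s hs
  · exact exchange_pushCrossing_of_ne hh hbox (fun o' e => hu (.inl ⟨_, _, e⟩)) hu'
  · exact column _ s hs

end Push

section Realizes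

variable {R : Type*} [CommRing R] {D : LinkDiagram R S.Chord S.BasePoint} {s : ℤˣ}

open Classical in
variable (S) in
/-- The algebra maps of the moves pushing the box. The sign in a Reidemeister III map is `1` if the
crossing of the two upper strands belongs to the box, that is, if the box passes over the third
strand. -/
noncomputable def loopMap (t : S.BasePoint → Rˣ) :
    DiagramMove S.Chord S.BasePoint → (S.Alg R →ₐ[R] S.Alg R)
  | .triple tm tb mb => substitution tb (FreeAlgebra.ι R tb +
      (if ∃ ℓ, tm = .box ℓ then 1 else -1 : R) • (FreeAlgebra.ι R tm * FreeAlgebra.ι R mb))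
  | .slide b x o back => substitution x
      (((if o = back then t b else (t b)⁻¹ : Rˣ) : R) • FreeAlgebra.ι R x)

theorem loopMap_triple_box (t : S.BasePoint → Rˣ) (ℓ : Fin S.γ.len) (x y : S.Chord) :
    S.loopMap t (.triple (.box ℓ) x y) =
      substitution x (FreeAlgebra.ι R x + FreeAlgebra.ι R (.box ℓ) * FreeAlgebra.ι R y) := by
  simp [loopMap]

theorem loopMap_triple_of_ne (t : S.BasePoint → Rˣ) {x : S.Chord} (hx : ∀ ℓ, x ≠ .box ℓ)
    (y a : S.Chord) :
    S.loopMap t (.triple x y a) =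
      substitution y (FreeAlgebra.ι R y - FreeAlgebra.ι R x * FreeAlgebra.ι R a) := by
  simp [loopMap, hx, sub_eq_add_neg]

/-- The strands of the box pass over (`o = true`) or under a strand `W` at the crossings `h` of the
sign `s`, and `W` meets these crossings one directly after the other, in a direction determined by
`o` and `s`. -/
structure Crossable (D : LinkDiagram R S.Chord S.BasePoint) (o : Bool) (h : Fin n → S.Chord)
    (s : ℤˣ) : Prop where
  injective : h.Injective
  ne_box (q : Fin n) (ℓ : Fin S.γ.len) : h q ≠ .box ℓ
  sign_box (ℓ : Fin S.γ.len) : D.sign (.box ℓ) = 1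
  sign_eq (q : Fin n) : D.sign (h q) = s
  adj (q q' : Fin n) (hq : (q : ℕ) + 1 = q') :
    D.adj (if o then s else -s) (through (!o) (h q)) (through (!o) (h q'))
  dirTop_eq (q q' : Fin n) (hq : (q : ℕ) + 1 = q') (ho : o = false) :
    D.dirTop (h q') (h q) = -s

variable {E : Equiv.Perm S.Pass} {c : Fin (S.γ.len + 1)} {ℓ : Fin S.γ.len}
  {L₁ L₂ : List (Fin S.γ.len)} {pre suf : Fin n → List S.Pass}

variable (hD : Crossable D o h s)
  (hW : ∀ q, (through o (h q) :: S.boxBraid q).IsChain D.follows)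

include hW in
theorem PushState.follows {suf : Fin n → List S.Pass} {q : Fin n} {u : S.Pass} {l : List S.Pass}
    (hE : S.PushState o h E c pre suf) (hu : suf q = u :: l) :
    (D.transport E).follows (through o (h q)) u := by
  have chain := isChain_transport (hW q) E
  rw [hE.word, hu] at chain
  exact isChain_iff_forall_infix.1 chain _ _ ⟨pre q, l, by simp⟩

include hD hW

theorem PushState.realizes_pushColumn
    (hE : S.PushState o h E c pre fun q => S.boxColumn c q ++ suf q) :
    (D.transport E).Realizes (S.loopMap D.label) (S.pushColumn o h c) := by
  refine realizes_slides (fun p => moveMap_slide _ _ _ _ _) (fun p p' e => by simpa using e)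
    (hD.injective.comp (S.γ.track c).symm.injective) (List.nodup_finRange n) fun p _ => ?_
  have hp := hE.follows hW (q := (S.γ.track c).symm p) rfl
  rwa [Equiv.apply_symm_apply] at hp

theorem PushState.movableCrossing
    (hE : S.PushState o h E ℓ.castSucc pre fun q => S.boxCrossing ℓ q ++ suf q) :
    (D.transport E).MovableCrossing o (.box ℓ) (S.crossingAt h ℓ.castSucc (S.γ.upper ℓ))
      (S.crossingAt h ℓ.castSucc (S.γ.lower ℓ)) s where
  ne_xy := crossingAt_ne hD.injective ℓ
  ne_xa := hD.ne_box _ _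
  ne_ya := hD.ne_box _ _
  sign_a := hD.sign_box ℓ
  sign_x := hD.sign_eq _
  sign_y := hD.sign_eq _
  follows_over := hE.follows (h := h) hW (l := suf ((S.γ.track ℓ).symm (S.γ.upper ℓ)))
    (by simp [boxCrossing, (S.γ.lower_ne_upper ℓ).symm])
  follows_under := hE.follows (h := h) hW (l := suf ((S.γ.track ℓ).symm (S.γ.lower ℓ)))
    (by simp [boxCrossing])
  adj := by
    rw [← hE.opposite, ← hE.opposite, adj_transport]
    exact hD.adj _ _ rfl
  dirTop_eq ho := by
    subst ho
    rw [dirTop_transport (hE.opposite _) (hE.opposite _)]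
    exact hD.dirTop_eq _ _ rfl rfl

theorem PushState.realizes_pushCrossing
    (hE : S.PushState o h E ℓ.castSucc pre fun q => S.boxCrossing ℓ q ++ suf q) :
    (D.transport E).Realizes (S.loopMap D.label) [S.pushCrossing o h ℓ] := by
  have hM := hE.movableCrossing hD hW
  refine ⟨hM.legalMove, ?_, trivial⟩
  cases o
  · exact hM.moveMap_under.trans (loopMap_triple_of_ne _ (hD.ne_box _) _ _).symm
  · exact hM.moveMap_over.trans (loopMap_triple_box _ _ _ _).symm

theorem LetterState.realizes (hL : (L₁ ++ ℓ :: L₂).Nodup)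
    (hE : LetterState o h E ℓ.castSucc L₁ (ℓ :: L₂)) :
    (D.transport E).Realizes (S.loopMap D.label)
      (S.pushColumn o h ℓ.castSucc ++ [S.pushCrossing o h ℓ]) := by
  have crossing := PushState.realizes_pushCrossing hD hW
    (hE.pushColumn hD.injective hD.ne_box hL)
  exact realizes_append.2 ⟨hE.of_cons.realizes_pushColumn hD hW, crossing⟩

theorem Crossable.realizes_pushBox :
    D.Realizes (S.loopMap D.label) (S.pushBox o h) := by
  obtain ⟨hE, realizes_letters⟩ := finRange_split_induction (motive := fun c L₁ L₂ =>
    LetterState o h (totalExchange (S.pushLetters o h L₁)) c L₁ L₂ ∧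
      D.Realizes (S.loopMap D.label) (S.pushLetters o h L₁)) ⟨letterState_start, trivial⟩
    fun ℓ L₁ L₂ hL ⟨hE, hD'⟩ => by
      refine ⟨?_, ?_⟩
      · rw [totalExchange_pushLetters_append]
        exact hE.pushLetter hD.injective hD.ne_box hL
      · rw [pushLetters, List.flatMap_append, List.flatMap_singleton]
        exact realizes_append.2 ⟨hD', hE.realizes hD hW hL⟩
  exact realizes_append.2 ⟨realizes_letters, hE.of_nil.realizes_pushColumn hD hW⟩

end Realizes

end SatelliteBraid

namespace SatelliteBraid

open Passage LinkDiagram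

variable {m n : ℕ} {S : SatelliteBraid m n}

section PushAll

/-- Push the box through several strands, one after the other. A strand is given by its crossings
with the box strands, and by whether the box passes over it. -/
def pushAll (H : List (Bool × (Fin n → S.Chord))) : List (DiagramMove S.Chord S.BasePoint) :=
  H.flatMap fun x => S.pushBox x.1 x.2

/-- The crossings in `H` are distinct and lie outside the box. -/
structure Separated (H : List (Bool × (Fin n → S.Chord))) : Prop where
  injective : ∀ x ∈ H, x.2.Injective
  ne_box : ∀ x ∈ H, ∀ q ℓ, x.2 q ≠ .box ℓ
  pairwise : H.Pairwise fun x y => ∀ q q', x.2 q ≠ y.2 q'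

/-- What the box strand `q` meets before the box if the box is to be pushed, against the
orientation, through the strands `H`. -/
def approach (H : List (Bool × (Fin n → S.Chord))) (q : Fin n) : List S.Pass :=
  (H.map fun x => through x.1 (x.2 q)).reverse

variable {x : Bool × (Fin n → S.Chord)} {H : List (Bool × (Fin n → S.Chord))}

theorem approach_cons (q : Fin n) :
    approach (x :: H) q = approach H q ++ [through x.1 (x.2 q)] := by
  simp [approach]

theorem not_isBoxPass_through {y : S.Chord} (hy : ∀ ℓ, y ≠ .box ℓ) (o : Bool) :
    ¬ S.IsBoxPass (through o y) :=
  fun hu => ne_through_of_isBoxPass hu hy o rfl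

theorem Separated.tail (hH : Separated (x :: H)) : Separated H :=
  ⟨fun y hy => hH.injective y (by simp [hy]), fun y hy => hH.ne_box y (by simp [hy]),
    (List.pairwise_cons.1 hH.pairwise).2⟩

theorem Separated.totalExchange_pushBox (hH : Separated (x :: H)) {y : Bool × (Fin n → S.Chord)}
    (hy : y ∈ H) (o : Bool) (q : Fin n) :
    totalExchange (S.pushBox x.1 x.2) (through o (y.2 q)) = through o (y.2 q) :=
  totalExchange_pushBox_of_ne (hH.injective x (by simp)) (hH.ne_box x (by simp))
    (not_isBoxPass_through (hH.ne_box y (by simp [hy]) q) o)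
    fun _ q' e => (List.pairwise_cons.1 hH.pairwise).1 y hy q' q (through_inj.1 e).2.symm

theorem Separated.map_approach (hH : Separated (x :: H)) (q : Fin n) :
    (approach H q).map (totalExchange (S.pushBox x.1 x.2)) = approach H q :=
  map_eq_self_of_forall_mem fun u hu => by
    obtain ⟨y, hy, rfl⟩ := List.mem_map.1 (List.mem_reverse.1 hu)
    exact hH.totalExchange_pushBox hy _ _

theorem totalExchange_pushAll_of_ne (hH : Separated H) {u : S.Pass} (hu : ¬ S.IsBoxPass u)
    (hu' : ∀ x ∈ H, ∀ o q, u ≠ through o (x.2 q)) : totalExchange (pushAll H) u = u := by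
  induction H with
  | nil => rfl
  | cons x H ih =>
    rw [pushAll, List.flatMap_cons, totalExchange_append, Equiv.Perm.mul_apply,
      totalExchange_pushBox_of_ne (hH.injective x (by simp)) (hH.ne_box x (by simp)) hu
        (hu' x (by simp))]
    exact ih hH.tail fun y hy => hu' y (by simp [hy])

theorem Separated.totalExchange_pushAll (hH : Separated (x :: H)) (o : Bool) (q : Fin n) :
    totalExchange (pushAll H) (through o (x.2 q)) = through o (x.2 q) :=
  totalExchange_pushAll_of_ne hH.tail (not_isBoxPass_through (hH.ne_box x (by simp) q) o)
    fun y hy _ q' e => (List.pairwise_cons.1 hH.pairwise).1 y hy q q' (through_inj.1 e).2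

theorem map_totalExchange_pushAll (hH : Separated H) (q : Fin n) :
    (approach H q ++ S.boxBraid q).map (totalExchange (pushAll H)) =
      S.boxBraid q ++ approach H q := by
  induction H with
  | nil => simp [pushAll, totalExchange, approach]
  | cons x H ih =>
    have push_head := (pushState_pushBox (o := x.1) (hH.injective x (by simp))
      (hH.ne_box x (by simp))).word q
    rw [pushAll, List.flatMap_cons, totalExchange_append, Equiv.Perm.coe_mul, ← List.map_map,
      approach_cons, List.append_assoc, List.singleton_append, List.map_append,
      hH.map_approach, push_head, ← List.append_assoc, List.map_append, ← pushAll, ih hH.tail]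
    simp only [List.map_cons, List.map_nil, hH.totalExchange_pushAll, List.append_assoc]

theorem totalExchange_pushAll_opposite (hH : Separated H) (hx : x ∈ H) (q : Fin n) :
    totalExchange (pushAll H) (through (!x.1) (x.2 q)) =
      through (!x.1) (x.2 (S.γ.perm.symm q)) := by
  induction H with
  | nil => simp at hx
  | cons y H ih =>
    rw [pushAll, List.flatMap_cons, totalExchange_append, Equiv.Perm.mul_apply, ← pushAll]
    rcases List.mem_cons.1 hx with rfl | hx
    · rw [(pushState_pushBox (hH.injective x (by simp)) (hH.ne_box x (by simp))).opposite,
        crossingAt, hH.totalExchange_pushAll]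
      rfl
    · rw [hH.totalExchange_pushBox hx, ih hH.tail hx]

variable {R : Type*} [CommRing R] {D : LinkDiagram R S.Chord S.BasePoint}

theorem Crossable.transport {o : Bool} {h : Fin n → S.Chord} {s : ℤˣ} (hD : Crossable D o h s)
    {E : Equiv.Perm S.Pass} (hE : ∀ q, E (through (!o) (h q)) = through (!o) (h q)) :
    Crossable (D.transport E) o h s where
  injective := hD.injective
  ne_box := hD.ne_box
  sign_box := hD.sign_box
  sign_eq := hD.sign_eq
  adj q q' hq := by
    rw [← hE q, ← hE q', adj_transport]
    exact hD.adj q q' hq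
  dirTop_eq q q' hq ho := by
    subst ho
    rw [dirTop_transport (hE q') (hE q)]
    exact hD.dirTop_eq q q' hq rfl

theorem realizes_pushAll (hH : Separated H) (hD : ∀ x ∈ H, ∃ s, Crossable D x.1 x.2 s)
    (hW : ∀ q, (approach H q ++ S.boxBraid q).IsChain D.follows) :
    D.Realizes (S.loopMap D.label) (pushAll H) := by
  induction H generalizing D with
  | nil => trivial
  | cons x H ih =>
    obtain ⟨s, hx⟩ := hD x (by simp)
    simp only [approach_cons, List.append_assoc, List.singleton_append] at hW
    rw [pushAll, List.flatMap_cons, realizes_append]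
    refine ⟨hx.realizes_pushBox fun q => (List.isChain_append.1 (hW q)).2.1,
      ih hH.tail (D := D.transport _) (fun y hy => ?_) fun q => ?_⟩
    · obtain ⟨s, hy'⟩ := hD y (by simp [hy])
      exact ⟨s, hy'.transport fun q => hH.totalExchange_pushBox hy _ q⟩
    · have chain := isChain_transport (hW q) (totalExchange (S.pushBox x.1 x.2))
      rw [List.map_append, hH.map_approach, (pushState_pushBox (hH.injective x (by simp))
        (hH.ne_box x (by simp))).word q, ← List.append_assoc] at chain
      exact (List.isChain_append.1 chain).1

end PushAll

/-! ### The loop and its final diagram -/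

variable (S)

/-- Whether the satellite strands are the overstrands at the crossing `ℓ` of `β`. -/
def satIsOver (ℓ : Fin S.β.len) : Bool := decide (S.satPos ℓ = S.β.upper ℓ)

/-- The groups of crossings through which the box is pushed in `β`. -/
def braidGroups : List (Bool × (Fin n → S.Chord)) :=
  (List.finRange S.β.len).reverse.flatMap fun ℓ =>
    if h : S.IsSat ℓ then [(S.satIsOver ℓ, .sat ⟨ℓ, h⟩)] else []

/-- The groups of crossings through which the box is pushed on the returning strands. -/
def returningGroups : List (Bool × (Fin n → S.Chord)) :=
  S.strands.reverse.map fun j => (true, fun q => .c (.inr q) j)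

/-- The groups of crossings through which the box is pushed on the leaving strands. -/
def leavingGroups : List (Bool × (Fin n → S.Chord)) :=
  S.strands.map fun i => (false, fun q => .c (i.map id S.γ.perm.symm) (.inr q))

theorem purpleLoop_eq : S.purpleLoop =
    pushAll S.braidGroups ++ pushAll S.returningGroups ++ pushAll S.leavingGroups := by
  have hbraid : pushAll S.braidGroups = S.pushThroughBraid := by
    rw [pushAll, braidGroups, pushThroughBraid, List.flatMap_assoc]
    refine List.flatMap_congr fun ℓ _ => ?_
    split_ifs <;> simp [satIsOver]
  rw [hbraid, pushAll, returningGroups, List.flatMap_map, pushAll, leavingGroups,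
    List.flatMap_map]
  rfl

theorem mem_block {i : Fin (m + 1)} {x : S.Strand} :
    x ∈ S.block i ↔ Sum.elim Subtype.val (fun _ => S.k) x = i := by
  unfold block
  split_ifs with h
  · rcases x with x | x
    · simpa using fun e => x.2 (e.trans h)
    · simp [h]
  · rcases x with x | x
    · simp [Subtype.ext_iff]
    · simpa using fun e => h e.symm

theorem mem_strands (x : S.Strand) : x ∈ S.strands := by
  simp [strands, mem_block]

theorem nodup_strands : S.strands.Nodup := by
  rw [strands, List.nodup_flatMap]
  refine ⟨fun i _ => ?_, (List.nodup_finRange _).imp fun {i j} hij x hi hj => hij ?_⟩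
  · unfold block
    split_ifs
    · exact (List.nodup_finRange n).map Sum.inr_injective
    · simp
  · rw [← S.mem_block.1 hi, ← S.mem_block.1 hj]

variable {S} {x : Bool × (Fin n → S.Chord)}

theorem mem_braidGroups :
    x ∈ S.braidGroups ↔ ∃ ℓ : {ℓ // S.IsSat ℓ}, x = (S.satIsOver ℓ, .sat ℓ) := by
  simp only [braidGroups, List.mem_flatMap, List.mem_reverse, List.mem_finRange, true_and,
    Subtype.exists]
  refine exists_congr fun ℓ => ?_
  split_ifs with h <;> simp [h]

theorem mem_returningGroups :
    x ∈ S.returningGroups ↔ ∃ j, x = (true, fun q => .c (.inr q) j) := by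
  simp [returningGroups, mem_strands, eq_comm]

theorem mem_leavingGroups :
    x ∈ S.leavingGroups ↔ ∃ i : S.Strand, x = (false, fun q => .c i (.inr q)) := by
  simp only [leavingGroups, List.mem_map, mem_strands, true_and]
  refine ⟨fun ⟨i, h⟩ => ⟨_, h.symm⟩, fun ⟨i, h⟩ => ⟨i.map id S.γ.perm, ?_⟩⟩
  simp [h]

theorem separated_braidGroups : Separated S.braidGroups where
  injective x hx := by
    obtain ⟨ℓ, rfl⟩ := mem_braidGroups.1 hx
    exact fun q q' e => by simpa using e
  ne_box x hx := by
    obtain ⟨ℓ, rfl⟩ := mem_braidGroups.1 hx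
    simp
  pairwise := by
    rw [braidGroups, List.pairwise_flatMap]
    refine ⟨fun ℓ _ => by split_ifs <;> simp,
      (List.nodup_reverse.2 (List.nodup_finRange _)).imp fun {ℓ ℓ'} hℓ x hx y hy q q' => ?_⟩
    split_ifs at hx hy <;> simp_all

theorem separated_returningGroups : Separated S.returningGroups where
  injective x hx := by
    obtain ⟨j, rfl⟩ := mem_returningGroups.1 hx
    exact fun q q' e => by simpa using e
  ne_box x hx := by
    obtain ⟨j, rfl⟩ := mem_returningGroups.1 hx
    simp
  pairwise := by
    rw [returningGroups, List.pairwise_map]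
    exact (List.nodup_reverse.2 S.nodup_strands).imp fun hij => by simp [hij]

theorem separated_leavingGroups : Separated S.leavingGroups where
  injective x hx := by
    obtain ⟨i, rfl⟩ := mem_leavingGroups.1 hx
    exact fun q q' e => by simpa using e
  ne_box x hx := by
    obtain ⟨i, rfl⟩ := mem_leavingGroups.1 hx
    simp
  pairwise := by
    have map_injective : Function.Injective (Sum.map id S.γ.perm.symm : S.Strand → S.Strand) :=
      Sum.map_injective.2 ⟨Function.injective_id, S.γ.perm.symm.injective⟩
    rw [leavingGroups, List.pairwise_map]
    exact S.nodup_strands.imp fun hij q q' e => hij (map_injective (Chord.c.inj e).1)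

section Place

/-- The satellite strands are permuted by `e₁` in the groups of `β`, by `e₂` in the rows and by
`e₃` in the columns of the chords `c_{ij}`. -/
def placeEach (e₁ e₂ e₃ : Equiv.Perm (Fin n)) : S.Chord → S.Chord
  | .c i j => .c (i.map id e₂) (j.map id e₃)
  | .box ℓ => .box ℓ
  | .outer ℓ => .outer ℓ
  | .sat ℓ q => .sat ℓ (e₁ q)

theorem rename_rename_placeEach (e₁ e₂ e₃ f₁ f₂ f₃ : Equiv.Perm (Fin n)) (u : S.Pass) :
    (u.rename (placeEach e₁ e₂ e₃)).rename (placeEach f₁ f₂ f₃) =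
      u.rename (placeEach (f₁ * e₁) (f₂ * e₂) (f₃ * e₃)) := by
  rcases u with (_ | _ | _ | _) | (_ | _ | _ | _) | _ <;> simp [Passage.rename, placeEach]

theorem rename_through (f : S.Chord → S.Chord) (o : Bool) (y : S.Chord) :
    (through o y : S.Pass).rename f = through o (f y) := by
  cases o <;> rfl

theorem exists_through_or_pt (u : S.Pass) : (∃ o y, u = through o y) ∨ ∃ b, u = .pt b := by
  rcases u with y | y | b
  · exact .inl ⟨true, y, rfl⟩
  · exact .inl ⟨false, y, rfl⟩
  · exact .inr ⟨b, rfl⟩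

theorem totalExchange_pushAll_eq_rename {H : List (Bool × (Fin n → S.Chord))} (hH : Separated H)
    {f : S.Chord → S.Chord} (hf : ∀ x ∈ H, ∀ q, f (x.2 q) = x.2 (S.γ.perm.symm q))
    (hf' : ∀ y, (∀ x ∈ H, ∀ q, y ≠ x.2 q) → f y = y) {u : S.Pass} (hu : ¬ S.IsBoxPass u)
    (hu' : ∀ x ∈ H, ∀ q, u ≠ through x.1 (x.2 q)) :
    totalExchange (pushAll H) u = u.rename f := by
  rcases exists_through_or_pt u with ⟨o, y, rfl⟩ | ⟨b, rfl⟩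
  · rw [rename_through]
    by_cases hy : ∀ x ∈ H, ∀ q, y ≠ x.2 q
    · rw [hf' y hy]
      exact totalExchange_pushAll_of_ne hH hu fun x hx o' q e => hy x hx q (through_inj.1 e).2
    · push Not at hy
      obtain ⟨x, hx, q, rfl⟩ := hy
      obtain rfl : o = !x.1 := Bool.eq_not_of_ne fun e => hu' x hx q (e ▸ rfl)
      rw [hf x hx, totalExchange_pushAll_opposite hH hx]
  · exact totalExchange_pushAll_of_ne hH hu fun _ _ _ _ => through_ne_pt.symm

variable {u : S.Pass}

theorem totalExchange_pushAll_braidGroups (hu : ¬ S.IsBoxPass u)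
    (hu' : ∀ (ℓ : {ℓ // S.IsSat ℓ}) (q : Fin n), u ≠ through (S.satIsOver ℓ) (.sat ℓ q)) :
    totalExchange (pushAll S.braidGroups) u = u.rename (placeEach S.γ.perm.symm 1 1) := by
  refine totalExchange_pushAll_eq_rename separated_braidGroups (fun x hx q => ?_)
    (fun y hy => ?_) hu fun x hx q => ?_
  · obtain ⟨ℓ, rfl⟩ := mem_braidGroups.1 hx
    rfl
  · rcases y with _ | _ | _ | ⟨ℓ, q⟩
    · simp [placeEach]
    · rfl
    · rfl
    · exact absurd rfl (hy _ (mem_braidGroups.2 ⟨ℓ, rfl⟩) q)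
  · obtain ⟨ℓ, rfl⟩ := mem_braidGroups.1 hx
    exact hu' ℓ q

theorem totalExchange_pushAll_returningGroups (hu : ¬ S.IsBoxPass u)
    (hu' : ∀ q j, u ≠ .over (.c (.inr q) j)) :
    totalExchange (pushAll S.returningGroups) u = u.rename (placeEach 1 S.γ.perm.symm 1) := by
  refine totalExchange_pushAll_eq_rename separated_returningGroups (fun x hx q => ?_)
    (fun y hy => ?_) hu fun x hx q => ?_
  · obtain ⟨j, rfl⟩ := mem_returningGroups.1 hx
    simp [placeEach]
  · rcases y with ⟨i | q, j⟩ | _ | _ | _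
    · simp [placeEach]
    · exact absurd rfl (hy _ (mem_returningGroups.2 ⟨j, rfl⟩) q)
    all_goals rfl
  · obtain ⟨j, rfl⟩ := mem_returningGroups.1 hx
    exact hu' q j

theorem totalExchange_pushAll_leavingGroups (hu : ¬ S.IsBoxPass u)
    (hu' : ∀ i q, u ≠ .under (.c i (.inr q))) :
    totalExchange (pushAll S.leavingGroups) u = u.rename (placeEach 1 1 S.γ.perm.symm) := by
  refine totalExchange_pushAll_eq_rename separated_leavingGroups (fun x hx q => ?_)
    (fun y hy => ?_) hu fun x hx q => ?_
  · obtain ⟨i, rfl⟩ := mem_leavingGroups.1 hx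
    simp [placeEach]
  · rcases y with ⟨i, j | q⟩ | _ | _ | _
    · simp [placeEach]
    · exact absurd rfl (hy _ (mem_leavingGroups.2 ⟨i, rfl⟩) q)
    all_goals rfl
  · obtain ⟨i, rfl⟩ := mem_leavingGroups.1 hx
    exact hu' i q

end Place

section Words

theorem mem_outerCrossing {ℓ : Fin S.β.len} {p : Fin (m + 1)} (hp : p ≠ S.satPos ℓ) {u : S.Pass}
    (hu : u ∈ S.outerCrossing ℓ p) :
    (∃ o h, u = through o (.outer ⟨ℓ, h⟩)) ∨
      ∃ h q, u = through (!S.satIsOver ℓ) (.sat ⟨ℓ, h⟩ q) := by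
  unfold outerCrossing at hu
  split_ifs at hu with h_lower h_sat h_upper h_sat
  · obtain ⟨q, -, rfl⟩ := List.mem_map.1 hu
    have : S.satPos ℓ = S.β.upper ℓ := h_sat.resolve_left fun e => hp (h_lower.trans e.symm)
    exact .inr ⟨h_sat, q, by simp [satIsOver, this, through]⟩
  · exact .inl ⟨false, h_sat, List.mem_singleton.1 hu⟩
  · obtain ⟨q, -, rfl⟩ := List.mem_map.1 hu
    have : S.satPos ℓ ≠ S.β.upper ℓ := fun e => hp (h_upper.trans e.symm)
    exact .inr ⟨h_sat, q, by simp [satIsOver, this, through]⟩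
  · exact .inl ⟨true, h_sat, List.mem_singleton.1 hu⟩
  · simp at hu

theorem mem_outerBraid {i : {i : Fin (m + 1) // i ≠ S.k}} {u : S.Pass}
    (hu : u ∈ S.outerBraid i) :
    (∃ ℓ p, u = .pt (.outer ℓ p)) ∨ (∃ o ℓ, u = through o (.outer ℓ)) ∨
      ∃ ℓ q, u = through (!S.satIsOver ℓ.1) (.sat ℓ q) := by
  rcases List.mem_append.1 hu with hu | hu
  · obtain ⟨ℓ, -, hu⟩ := List.mem_flatMap.1 hu
    rcases List.mem_cons.1 hu with rfl | hu
    · exact .inl ⟨_, _, rfl⟩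
    · have track_ne : S.β.track ℓ i ≠ S.satPos ℓ := fun e => i.2 (Equiv.injective _ e)
      rcases mem_outerCrossing track_ne hu with ⟨o, h, rfl⟩ | ⟨h, q, rfl⟩
      · exact .inr (.inl ⟨_, _, rfl⟩)
      · exact .inr (.inr ⟨⟨ℓ, h⟩, q, rfl⟩)
  · exact .inl ⟨_, _, List.mem_singleton.1 hu⟩

theorem satBraid_eq (q : Fin n) : S.satBraid q = approach S.braidGroups q := by
  rw [approach, braidGroups, satBraid, List.map_flatMap, List.reverse_flatMap,
    List.reverse_reverse]
  refine List.flatMap_congr fun ℓ _ => ?_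
  simp only [Function.comp_apply]
  split_ifs with h_sat h_lower
  · have : S.satPos ℓ ≠ S.β.upper ℓ := fun e => S.β.lower_ne_upper ℓ (h_lower.symm.trans e)
    simp [satIsOver, this, through]
  · simp [satIsOver, h_sat.resolve_left h_lower, through]
  · rfl

theorem mem_satBraid {q : Fin n} {u : S.Pass} (hu : u ∈ S.satBraid q) :
    ∃ ℓ : {ℓ // S.IsSat ℓ}, u = through (S.satIsOver ℓ) (.sat ℓ q) := by
  rw [satBraid_eq, approach, List.mem_reverse] at hu
  obtain ⟨x, hx, rfl⟩ := List.mem_map.1 hu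
  obtain ⟨ℓ, rfl⟩ := mem_braidGroups.1 hx
  exact ⟨ℓ, rfl⟩

theorem mem_leavingPass {j : S.Strand} {u : S.Pass} (hu : u ∈ S.leavingPass j) :
    (∃ j i, u = .pt (.leaving j i)) ∨ ∃ i, u = .under (.c i j) := by
  obtain ⟨i, -, hu⟩ := List.mem_flatMap.1 hu
  rcases List.mem_append.1 hu with hu | hu
  · rcases j with j | j
    · exact .inl ⟨j, i, by simpa using hu⟩
    · simp at hu
  · obtain ⟨l, -, rfl⟩ := List.mem_map.1 hu
    exact .inr ⟨l, rfl⟩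

theorem mem_returningPass {i : S.Strand} {u : S.Pass} (hu : u ∈ S.returningPass i) :
    (∃ i j, u = .pt (.returning i j)) ∨ ∃ j, u = .over (.c i j) := by
  obtain ⟨j, -, hu⟩ := List.mem_flatMap.1 hu
  rcases List.mem_append.1 hu with hu | hu
  · rcases i with i | i
    · exact .inl ⟨i, j, by simpa using hu⟩
    · simp at hu
  · obtain ⟨l, -, rfl⟩ := List.mem_map.1 hu
    exact .inr ⟨l, rfl⟩

theorem leavingPass_inr (q : Fin n) :
    S.leavingPass (.inr q) = S.strands.reverse.map fun i => .under (.c i (.inr q)) := by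
  simp [leavingPass, strands, List.map_flatMap, List.reverse_flatMap, Function.comp_def]

theorem returningPass_inr (q : Fin n) :
    S.returningPass (.inr q) = S.strands.map fun j => .over (.c (.inr q) j) := by
  simp [returningPass, strands, List.map_flatMap]

theorem approach_returningGroups (q : Fin n) :
    approach S.returningGroups q = S.returningPass (.inr q) := by
  simp [returningPass_inr, approach, returningGroups, through]

theorem approach_leavingGroups (q : Fin n) : approach S.leavingGroups q =
    (S.leavingPass (.inr q)).map (rename (placeEach 1 S.γ.perm.symm 1)) := by
  simp [leavingPass_inr, approach, leavingGroups, through, rename, placeEach]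

/-- The passages on the satellite strands. -/
def IsSatPass : S.Pass → Prop
  | .over (.c i _) => i.isRight = true
  | .under (.c _ j) => j.isRight = true
  | .over (.sat ℓ _) => S.satIsOver ℓ = true
  | .under (.sat ℓ _) => S.satIsOver ℓ = false
  | .over (.box _) | .under (.box _) | .pt (.box _ _) => True
  | .over (.outer _) | .under (.outer _) => False
  | .pt (.outer _ _) | .pt (.leaving _ _) | .pt (.returning _ _) => False

theorem isSatPass_rename_placeEach (e₁ e₂ e₃ : Equiv.Perm (Fin n)) (u : S.Pass) :
    IsSatPass (u.rename (placeEach e₁ e₂ e₃)) ↔ IsSatPass u := by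
  rcases u with (_ | _ | _ | _) | (_ | _ | _ | _) | _ <;> simp [rename, placeEach, IsSatPass]

theorem isSatPass_through (ℓ : {ℓ // S.IsSat ℓ}) (o : Bool) (q : Fin n) :
    IsSatPass (through o (.sat ℓ q) : S.Pass) ↔ o = S.satIsOver ℓ := by
  cases o <;> exact eq_comm

theorem isSatPass_of_isBoxPass {u : S.Pass} (hu : S.IsBoxPass u) : IsSatPass u := by
  rcases hu with ⟨o, ℓ, rfl⟩ | ⟨c, p, rfl⟩
  · cases o <;> trivial
  · trivial

theorem not_isSatPass_of_mem_strandWord_inl {i : {i : Fin (m + 1) // i ≠ S.k}} {u : S.Pass}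
    (hu : u ∈ S.strandWord (.inl i)) : ¬ IsSatPass u := by
  rcases List.mem_append.1 hu with hu | hu
  · rcases List.mem_append.1 hu with hu | hu
    · rcases mem_outerBraid hu with ⟨ℓ, p, rfl⟩ | ⟨o, ℓ, rfl⟩ | ⟨ℓ, q, rfl⟩
      · exact id
      · cases o <;> exact id
      · simp [isSatPass_through]
    · rcases mem_leavingPass hu with ⟨j, i, rfl⟩ | ⟨j, rfl⟩ <;> simp [IsSatPass, exit]
  · rcases mem_returningPass hu with ⟨j, i, rfl⟩ | ⟨j, rfl⟩ <;> simp [IsSatPass, exit]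

end Words

section Stages

theorem map_totalExchange_braidGroups {l : List S.Pass} (hl : ∀ u ∈ l, ¬ IsSatPass u) :
    l.map (totalExchange (pushAll S.braidGroups)) =
      l.map (rename (placeEach S.γ.perm.symm 1 1)) :=
  List.map_congr_left fun u hu =>
    totalExchange_pushAll_braidGroups (fun h => hl u hu (isSatPass_of_isBoxPass h))
      fun ℓ q e => hl u hu (e ▸ (isSatPass_through ℓ _ q).2 rfl)

theorem map_totalExchange_returningGroups {l : List S.Pass} (hl : ∀ u ∈ l, ¬ IsSatPass u) :
    l.map (totalExchange (pushAll S.returningGroups)) =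
      l.map (rename (placeEach 1 S.γ.perm.symm 1)) :=
  List.map_congr_left fun u hu =>
    totalExchange_pushAll_returningGroups (fun h => hl u hu (isSatPass_of_isBoxPass h))
      fun _ _ e => hl u hu (e ▸ rfl)

theorem map_totalExchange_leavingGroups {l : List S.Pass} (hl : ∀ u ∈ l, ¬ IsSatPass u) :
    l.map (totalExchange (pushAll S.leavingGroups)) =
      l.map (rename (placeEach 1 1 S.γ.perm.symm)) :=
  List.map_congr_left fun u hu =>
    totalExchange_pushAll_leavingGroups (fun h => hl u hu (isSatPass_of_isBoxPass h))
      fun _ _ e => hl u hu (e ▸ rfl)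

theorem totalExchange_braidGroups_through_c (o : Bool) (i j : S.Strand) :
    totalExchange (pushAll S.braidGroups) (through o (.c i j)) = through o (.c i j) :=
  totalExchange_pushAll_of_ne separated_braidGroups (not_isBoxPass_through (by simp) o)
    fun x hx _ _ => by
      obtain ⟨ℓ, rfl⟩ := mem_braidGroups.1 hx
      simp [through_inj]

theorem totalExchange_returningGroups_through_sat (o : Bool) (ℓ : {ℓ // S.IsSat ℓ}) (q : Fin n) :
    totalExchange (pushAll S.returningGroups) (through o (.sat ℓ q)) = through o (.sat ℓ q) :=
  totalExchange_pushAll_of_ne separated_returningGroups (not_isBoxPass_through (by simp) o)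
    fun x hx _ _ => by
      obtain ⟨j, rfl⟩ := mem_returningGroups.1 hx
      simp [through_inj]

theorem totalExchange_leavingGroups_through_sat (o : Bool) (ℓ : {ℓ // S.IsSat ℓ}) (q : Fin n) :
    totalExchange (pushAll S.leavingGroups) (through o (.sat ℓ q)) = through o (.sat ℓ q) :=
  totalExchange_pushAll_of_ne separated_leavingGroups (not_isBoxPass_through (by simp) o)
    fun x hx _ _ => by
      obtain ⟨i, rfl⟩ := mem_leavingGroups.1 hx
      simp [through_inj]

variable (S) in
/-- The words of the diagram after the box has been pushed through `β`. -/
def wordAfterBraid : S.Strand → List S.Pass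
  | .inl i => (S.strandWord (.inl i)).map (rename (placeEach S.γ.perm.symm 1 1))
  | .inr q => S.satBraid q ++ S.leavingPass (.inr (S.γ.perm q)) ++
      S.returningPass (.inr (S.γ.perm q)) ++ S.boxBraid (S.γ.perm q)

variable (S) in
/-- The words of the diagram after the box has also been pushed along the returning strands. -/
def wordAfterReturning : S.Strand → List S.Pass
  | .inl i => (S.strandWord (.inl i)).map (rename (placeEach S.γ.perm.symm S.γ.perm.symm 1))
  | .inr q => S.satBraid q ++
      (S.leavingPass (.inr (S.γ.perm q))).map (rename (placeEach 1 S.γ.perm.symm 1)) ++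
      S.boxBraid (S.γ.perm q) ++ S.returningPass (.inr (S.γ.perm q))

variable (S) in
/-- The words of the diagram after the purple-box loop. -/
def wordAfterLoop : S.Strand → List S.Pass
  | .inl i => (S.strandWord (.inl i)).map
      (rename (placeEach S.γ.perm.symm S.γ.perm.symm S.γ.perm.symm))
  | .inr q => S.satBraid q ++ S.boxBraid (S.γ.perm q) ++
      (S.leavingPass (.inr (S.γ.perm q))).map (rename (placeEach 1 S.γ.perm.symm 1)) ++
      (S.returningPass (.inr (S.γ.perm q))).map (rename (placeEach 1 1 S.γ.perm.symm))

theorem map_braidGroups_strandWord_inr (q : Fin n) :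
    (S.strandWord (.inr q)).map (totalExchange (pushAll S.braidGroups)) =
      S.boxBraid q ++ (S.satBraid q ++ S.leavingPass (.inr (S.γ.perm q)) ++
        S.returningPass (.inr (S.γ.perm q))) := by
  have leaving : (S.leavingPass (.inr (S.γ.perm q))).map
      (totalExchange (pushAll S.braidGroups)) = S.leavingPass (.inr (S.γ.perm q)) := by
    rw [leavingPass_inr, List.map_map]
    exact List.map_congr_left fun i _ => totalExchange_braidGroups_through_c false _ _
  have returning : (S.returningPass (.inr (S.γ.perm q))).map
      (totalExchange (pushAll S.braidGroups)) = S.returningPass (.inr (S.γ.perm q)) := by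
    rw [returningPass_inr, List.map_map]
    exact List.map_congr_left fun j _ => totalExchange_braidGroups_through_c true _ _
  rw [strandWord, List.map_append, List.map_append, exit, leaving, returning, satBraid_eq,
    map_totalExchange_pushAll separated_braidGroups]
  simp only [List.append_assoc]

theorem map_returningGroups_wordAfterBraid (i : S.Strand) :
    (S.wordAfterBraid i).map (totalExchange (pushAll S.returningGroups)) =
      S.wordAfterReturning i := by
  rcases i with i | q
  · rw [wordAfterBraid, map_totalExchange_returningGroups, List.map_map, wordAfterReturning]
    · exact List.map_congr_left fun u _ => rename_rename_placeEach ..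
    · simpa [isSatPass_rename_placeEach] using fun u => not_isSatPass_of_mem_strandWord_inl
  · have sat : (S.satBraid q).map (totalExchange (pushAll S.returningGroups)) = S.satBraid q :=
      map_eq_self_of_forall_mem fun u hu => by
        obtain ⟨ℓ, rfl⟩ := mem_satBraid hu
        exact totalExchange_returningGroups_through_sat _ _ _
    have leaving : (S.leavingPass (.inr (S.γ.perm q))).map
        (totalExchange (pushAll S.returningGroups)) =
          (S.leavingPass (.inr (S.γ.perm q))).map (rename (placeEach 1 S.γ.perm.symm 1)) := by
      rw [leavingPass_inr, List.map_map, List.map_map]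
      exact List.map_congr_left fun i _ => totalExchange_pushAll_returningGroups
        (not_isBoxPass_through (by simp) false) (by simp)
    rw [wordAfterBraid, List.append_assoc, List.map_append, List.map_append, sat, leaving,
      ← approach_returningGroups, map_totalExchange_pushAll separated_returningGroups,
      wordAfterReturning, approach_returningGroups]
    simp only [List.append_assoc]

theorem map_leavingGroups_wordAfterReturning (i : S.Strand) :
    (S.wordAfterReturning i).map (totalExchange (pushAll S.leavingGroups)) =
      S.wordAfterLoop i := by
  rcases i with i | q
  · rw [wordAfterReturning, map_totalExchange_leavingGroups, List.map_map, wordAfterLoop]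
    · exact List.map_congr_left fun u _ => rename_rename_placeEach ..
    · simpa [isSatPass_rename_placeEach] using fun u => not_isSatPass_of_mem_strandWord_inl
  · have sat : (S.satBraid q).map (totalExchange (pushAll S.leavingGroups)) = S.satBraid q :=
      map_eq_self_of_forall_mem fun u hu => by
        obtain ⟨ℓ, rfl⟩ := mem_satBraid hu
        exact totalExchange_leavingGroups_through_sat _ _ _
    have returning : (S.returningPass (.inr (S.γ.perm q))).map
        (totalExchange (pushAll S.leavingGroups)) =
          (S.returningPass (.inr (S.γ.perm q))).map (rename (placeEach 1 1 S.γ.perm.symm)) := by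
      rw [returningPass_inr, List.map_map, List.map_map]
      exact List.map_congr_left fun i _ => totalExchange_pushAll_leavingGroups
        (not_isBoxPass_through (by simp) true) (by simp)
    rw [wordAfterReturning, ← approach_leavingGroups, List.append_assoc (S.satBraid q),
      List.map_append, List.map_append, sat, returning,
      map_totalExchange_pushAll separated_leavingGroups, wordAfterLoop, approach_leavingGroups]
    simp only [List.append_assoc]

variable {R : Type*} [CommRing R] (t : S.BasePoint → Rˣ)

theorem exit_injective : Function.Injective S.exit := by
  rintro (i | i) (j | j) h
  · simpa [exit, Subtype.ext_iff] using h
  · simp [exit] at h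
  · simp [exit] at h
  · simpa [exit] using h

/-- The permutation of the strands in one turn around the figure-eight unknot. -/
noncomputable def exitPerm : Equiv.Perm S.Strand :=
  Equiv.ofBijective S.exit (Finite.injective_iff_bijective.1 exit_injective)

/-- The diagram after the box has been pushed through `β`. -/
noncomputable def diagramAfterBraid : LinkDiagram R S.Chord S.BasePoint :=
  (S.diagram t).transport (totalExchange (pushAll S.braidGroups))

/-- The diagram after the box has also been pushed along the returning strands. -/
noncomputable def diagramAfterReturning : LinkDiagram R S.Chord S.BasePoint :=
  (diagramAfterBraid t).transport (totalExchange (pushAll S.returningGroups))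

theorem isTraversal_diagram : (S.diagram t).IsTraversal S.strandWord S.exit := fun _ _ => Iff.rfl

theorem strandWord_inl_ne_nil (i : {i : Fin (m + 1) // i ≠ S.k}) : S.strandWord (.inl i) ≠ [] := by
  simp [strandWord, outerBraid]

theorem boxBraid_ne_nil (q : Fin n) : S.boxBraid q ≠ [] := by
  simp [boxBraid]

theorem isTraversal_diagramAfterBraid :
    (diagramAfterBraid t).IsTraversal S.wordAfterBraid S.exit := by
  let V : S.Strand → List S.Pass := Sum.elim (fun _ => []) S.boxBraid
  let W : S.Strand → List S.Pass
    | .inl i => S.wordAfterBraid (.inl i)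
    | .inr q => S.satBraid q ++ S.leavingPass (.inr (S.γ.perm q)) ++
        S.returningPass (.inr (S.γ.perm q))
  have hV (i) : (S.strandWord i).map (totalExchange (pushAll S.braidGroups)) = V i ++ W i := by
    rcases i with i | q
    · exact map_totalExchange_braidGroups fun u => not_isSatPass_of_mem_strandWord_inl
    · exact map_braidGroups_strandWord_inr q
  have hW (i) : S.wordAfterBraid i = W i ++ V (exitPerm i) := by
    rcases i with i | q
    · exact (List.append_nil _).symm
    · rfl
  have h_traversal := (isTraversal_diagram t).transport (totalExchange (pushAll S.braidGroups))
  simp only [hV] at h_traversal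
  rw [show S.wordAfterBraid = _ from funext hW]
  refine IsTraversal.rotate (next := exitPerm) h_traversal ?_ ?_
  · rintro (i | q)
    · simp [V, W, wordAfterBraid, strandWord_inl_ne_nil]
    · simp [V, boxBraid_ne_nil]
  · rintro (i | q)
    · simp [W, wordAfterBraid, strandWord_inl_ne_nil]
    · simp [V, exitPerm, exit, boxBraid_ne_nil]

theorem isTraversal_diagramAfterReturning :
    (diagramAfterReturning t).IsTraversal S.wordAfterReturning S.exit := by
  rw [← funext map_returningGroups_wordAfterBraid]
  exact (isTraversal_diagramAfterBraid t).transport _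

theorem run_purpleLoop : (S.diagram t).run S.purpleLoop =
    (diagramAfterReturning t).transport (totalExchange (pushAll S.leavingGroups)) := by
  rw [purpleLoop_eq, run_eq_transport, totalExchange_append, totalExchange_append,
    transport_mul, transport_mul]
  rfl

theorem isTraversal_run_purpleLoop :
    ((S.diagram t).run S.purpleLoop).IsTraversal S.wordAfterLoop S.exit := by
  rw [run_purpleLoop, ← funext map_leavingGroups_wordAfterReturning]
  exact (isTraversal_diagramAfterReturning t).transport _

end Stages

section FinalDiagram

theorem placeEach_diagonal (e : Equiv.Perm (Fin n)) : placeEach e e e = S.place e := by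
  funext x
  cases x <;> rfl

/-- Renaming the crossings, as a permutation of the passages. -/
def renameEquiv {X B : Type*} (e : Equiv.Perm X) : Equiv.Perm (Passage X B) where
  toFun := rename e
  invFun := rename e.symm
  left_inv u := by cases u <;> simp [rename]
  right_inv u := by cases u <;> simp [rename]

theorem map_rename_identification_wordAfterLoop (i : S.Strand) :
    (S.wordAfterLoop i).map (rename S.identification) = S.strandWord (i.map id S.γ.perm) := by
  rcases i with i | q
  · rw [wordAfterLoop, placeEach_diagonal, List.map_map]
    exact map_eq_self_of_forall_mem fun u _ =>
      (renameEquiv S.identification).apply_symm_apply u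
  · have sat : (S.satBraid q).map (rename S.identification) = S.satBraid (S.γ.perm q) := by
      rw [satBraid, List.map_flatMap, satBraid]
      refine List.flatMap_congr fun ℓ _ => ?_
      split_ifs <;> rfl
    have box : (S.boxBraid (S.γ.perm q)).map (rename S.identification) =
        S.boxBraid (S.γ.perm q) :=
      map_eq_self_of_forall_mem fun u hu => by
        rcases isBoxPass_of_mem_boxBraid hu with ⟨o, ℓ, rfl⟩ | ⟨c, p, rfl⟩
        · exact rename_through _ _ _
        · rfl
    have leaving : ((S.leavingPass (.inr (S.γ.perm q))).map
        (rename (placeEach 1 S.γ.perm.symm 1))).map (rename S.identification) =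
          S.leavingPass (.inr (S.γ.perm (S.γ.perm q))) := by
      rw [leavingPass_inr, leavingPass_inr, List.map_map, List.map_map]
      exact List.map_congr_left fun i _ => by simp [rename, placeEach, identification, place]
    have returning : ((S.returningPass (.inr (S.γ.perm q))).map
        (rename (placeEach 1 1 S.γ.perm.symm))).map (rename S.identification) =
          S.returningPass (.inr (S.γ.perm (S.γ.perm q))) := by
      rw [returningPass_inr, returningPass_inr, List.map_map, List.map_map]
      exact List.map_congr_left fun j _ => by simp [rename, placeEach, identification, place]
    rw [wordAfterLoop, List.map_append, List.map_append, List.map_append, sat, box, leaving,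
      returning]
    rfl

theorem exit_map_perm (i : S.Strand) :
    S.exit (i.map id S.γ.perm) = (S.exit i).map id S.γ.perm := by
  rcases i with i | q <;> rfl

theorem degree_place (e : Equiv.Perm (Fin n)) (x : S.Chord) : (S.place e x).degree = x.degree := by
  cases x <;> rfl

theorem relabel_run_purpleLoop {R : Type*} [CommRing R] (t : S.BasePoint → Rˣ) :
    ((S.diagram t).run S.purpleLoop).relabel S.identification = S.diagram t := by
  have h_traversal := (isTraversal_run_purpleLoop t).transport (renameEquiv S.identification)
  rw [show (fun i => (S.wordAfterLoop i).map (renameEquiv S.identification)) = _ from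
    funext map_rename_identification_wordAfterLoop] at h_traversal
  refine LinkDiagram.ext ?_ ?_ (by rw [run_purpleLoop]; rfl)
  · funext u v
    refine propext ((h_traversal u v).trans ?_)
    simp only [← exit_map_perm]
    exact (Equiv.sumCongr (Equiv.refl _) S.γ.perm).surjective.exists
      (p := fun i => [u, v] <:+: S.strandWord i ++ S.strandWord (S.exit i)) |>.symm
  · funext x
    rw [run_purpleLoop]
    exact congrArg ((-1 : ℤˣ) ^ ·) (degree_place _ x)

end FinalDiagram

/-! ### Legality -/

section Adjacency

theorem pair_infix_reverse_finRange {q q' : Fin n} (hq : (q : ℕ) + 1 = q') :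
    [q', q] <:+: (List.finRange n).reverse :=
  List.reverse_infix.2 (pair_infix_finRange hq)

theorem infix_flatMap {α β : Type*} {l : List α} {a : α} (ha : a ∈ l) (f : α → List β) :
    f a <:+: l.flatMap f := by
  obtain ⟨l₁, l₂, rfl⟩ := List.append_of_mem ha
  exact ⟨l₁.flatMap f, l₂.flatMap f, by simp⟩

theorem outerCrossing_infix (i : {i : Fin (m + 1) // i ≠ S.k}) (ℓ : Fin S.β.len) :
    S.outerCrossing ℓ (S.β.track ℓ i) <:+: S.strandWord (.inl i) :=
  calc
    _ <:+: .pt (.outer ℓ.castSucc (S.β.track ℓ i)) :: S.outerCrossing ℓ (S.β.track ℓ i) :=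
      (List.suffix_cons _ _).isInfix
    _ <:+: _ := infix_flatMap (List.mem_finRange ℓ) fun ℓ : Fin S.β.len =>
      .pt (.outer ℓ.castSucc (S.β.track ℓ i)) :: S.outerCrossing ℓ (S.β.track ℓ i)
    _ <:+: S.outerBraid i := (List.prefix_append _ _).isInfix
    _ <:+: S.strandWord (.inl i) :=
      ((List.prefix_append _ _).trans (List.prefix_append _ _)).isInfix

theorem leavingPass_pair {q q' : Fin n} (hq : (q : ℕ) + 1 = q') (j : S.Strand) :
    [.under (.c (.inr q') j), .under (.c (.inr q) j)] <:+: S.leavingPass j := by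
  refine .trans ?_ (infix_flatMap (List.mem_reverse.2 (List.mem_finRange S.k)) _)
  refine .trans ?_ (List.suffix_append _ _).isInfix
  simpa [block, Function.comp_def] using
    (pair_infix_reverse_finRange hq).map fun q => (.under (.c (.inr q) j) : S.Pass)

theorem returningPass_pair {q q' : Fin n} (hq : (q : ℕ) + 1 = q') (i : S.Strand) :
    [.over (.c i (.inr q)), .over (.c i (.inr q'))] <:+: S.returningPass i := by
  refine .trans ?_ (infix_flatMap (List.mem_finRange S.k) _)
  refine .trans ?_ (List.suffix_append _ _).isInfix
  simpa [block, Function.comp_def] using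
    (pair_infix_finRange hq).map fun q => (.over (.c i (.inr q)) : S.Pass)

theorem isSatPass_of_mem_strandWord_inr {q : Fin n} {u : S.Pass}
    (hu : u ∈ S.strandWord (.inr q)) : IsSatPass u := by
  rw [strandWord, exit, leavingPass_inr, returningPass_inr] at hu
  rcases List.mem_append.1 hu with hu | hu
  · rcases List.mem_append.1 hu with hu | hu
    · rcases List.mem_append.1 hu with hu | hu
      · obtain ⟨ℓ, rfl⟩ := mem_satBraid hu
        exact (isSatPass_through ℓ _ q).2 rfl
      · exact isSatPass_of_isBoxPass (isBoxPass_of_mem_boxBraid hu)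
    · obtain ⟨i, -, rfl⟩ := List.mem_map.1 hu
      rfl
  · obtain ⟨j, -, rfl⟩ := List.mem_map.1 hu
    rfl

theorem head?_strandWord_inl (i : {i : Fin (m + 1) // i ≠ S.k}) :
    ∃ b, (S.strandWord (.inl i)).head? = some (.pt b) := by
  unfold strandWord outerBraid
  cases List.finRange S.β.len <;> exact ⟨_, rfl⟩

theorem over_sat_mem_outerCrossing {ℓ : {ℓ // S.IsSat ℓ}} {q : Fin n} {k : Fin S.β.len}
    {p : Fin (m + 1)} (h : .over (.sat ℓ q) ∈ S.outerCrossing k p) : k = ℓ := by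
  unfold outerCrossing at h
  split_ifs at h <;>
    simp only [List.mem_map, List.mem_singleton, List.not_mem_nil, reduceCtorEq, and_false,
      exists_false, Passage.over.injEq, Chord.sat.injEq] at h
  obtain ⟨-, -, rfl, -⟩ := h
  rfl

theorem pairwise_outerCrossing (ℓ : {ℓ // S.IsSat ℓ}) (k : Fin S.β.len) (p : Fin (m + 1)) :
    (S.outerCrossing k p).Pairwise fun u v =>
      ∀ q q', u = .over (.sat ℓ q) → v = .over (.sat ℓ q') → q' < q := by
  unfold outerCrossing
  split_ifs
  · exact List.pairwise_map.2 (List.pairwise_of_forall fun _ _ => by simp)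
  · exact List.pairwise_singleton _ _
  · rw [List.pairwise_map, List.pairwise_reverse]
    refine (List.pairwise_lt_finRange n).imp fun {a b} hab q q' ha hb => ?_
    simp only [Passage.over.injEq, Chord.sat.injEq] at ha hb
    rwa [← ha.2, ← hb.2]
  · exact List.pairwise_singleton _ _
  · exact List.Pairwise.nil

theorem pairwise_strandWord_inl (ℓ : {ℓ // S.IsSat ℓ}) (i : {i : Fin (m + 1) // i ≠ S.k}) :
    (S.strandWord (.inl i)).Pairwise fun u v =>
      ∀ q q', u = .over (.sat ℓ q) → v = .over (.sat ℓ q') → q' < q := by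
  have grid {v : S.Pass} (hv : v ∈ S.leavingPass (S.exit (.inl i)) ++
      S.returningPass (S.exit (.inl i))) (q : Fin n) : v ≠ .over (.sat ℓ q) := by
    rcases List.mem_append.1 hv with h | h
    · rcases mem_leavingPass h with ⟨j, i, rfl⟩ | ⟨j, rfl⟩ <;> simp
    · rcases mem_returningPass h with ⟨j, i, rfl⟩ | ⟨j, rfl⟩ <;> simp
  rw [strandWord, List.append_assoc, List.pairwise_append]
  refine ⟨?_, List.pairwise_of_forall_mem_list fun u _ v hv _ q' _ e => (grid hv q' e).elim,
    fun u _ v hv _ q' _ e => (grid hv q' e).elim⟩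
  rw [outerBraid, List.pairwise_append, List.pairwise_flatMap]
  refine ⟨⟨fun k _ => ?_, (List.nodup_finRange _).imp fun {k k'} hne u hu v hv q q' eu ev =>
    (hne ?_).elim⟩, List.pairwise_singleton _ _, by simp⟩
  · exact List.pairwise_cons.2 ⟨by simp, pairwise_outerCrossing ℓ _ _⟩
  · subst eu ev
    rw [List.mem_cons, or_iff_right (by simp)] at hu hv
    rw [over_sat_mem_outerCrossing hu, over_sat_mem_outerCrossing hv]

variable {R : Type*} [CommRing R] (t : S.BasePoint → Rˣ)

theorem not_follows_over_sat {ℓ : {ℓ // S.IsSat ℓ}} (hℓ : S.satIsOver ℓ = false) {q q' : Fin n}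
    (hq : q ≤ q') : ¬ (S.diagram t).follows (.over (.sat ℓ q)) (.over (.sat ℓ q')) := by
  have not_mem_inr (p q : Fin n) : .over (.sat ℓ q) ∉ S.strandWord (.inr p) := fun h => by
    have := (isSatPass_through ℓ true q).1 (isSatPass_of_mem_strandWord_inr h)
    simp [hℓ] at this
  have not_infix (i : S.Strand) : ¬ [.over (.sat ℓ q), .over (.sat ℓ q')] <:+: S.strandWord i := by
    rcases i with i | p
    · exact fun h => hq.not_gt
        (List.pairwise_pair.1 ((pairwise_strandWord_inl ℓ i).sublist h.sublist) q q' rfl rfl)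
    · exact fun h => not_mem_inr p q (h.subset (by simp))
  rintro ⟨i, h⟩
  rcases pair_infix_append_iff.1 h with h | h | ⟨-, h⟩
  · exact not_infix _ h
  · exact not_infix _ h
  · cases hi : S.exit i with
    | inl j =>
      obtain ⟨b, hb⟩ := head?_strandWord_inl j
      simp [hi, hb] at h
    | inr p => exact not_mem_inr p q' (List.mem_of_mem_head? (hi ▸ h))

theorem follows_sat_lower {ℓ : {ℓ // S.IsSat ℓ}} (hℓ : S.satIsOver ℓ = true) {q q' : Fin n}
    (hq : (q : ℕ) + 1 = q') :
    (S.diagram t).follows (.under (.sat ℓ q)) (.under (.sat ℓ q')) := by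
  have upper : S.satPos ℓ = S.β.upper ℓ := of_decide_eq_true hℓ
  have ne_k : (S.β.track ℓ).symm (S.β.lower ℓ) ≠ S.k := fun e =>
    S.β.lower_ne_upper ℓ ((Equiv.symm_apply_eq _).1 e |>.trans upper)
  refine isChain_iff_forall_infix.1 ((isTraversal_diagram t).isChain (.inl ⟨_, ne_k⟩)) _ _
    (.trans ?_ (outerCrossing_infix _ ℓ))
  simpa [outerCrossing, ℓ.2] using
    (pair_infix_finRange hq).map fun q => (.under (.sat ℓ q) : S.Pass)

theorem follows_sat_upper {ℓ : {ℓ // S.IsSat ℓ}} (hℓ : S.satIsOver ℓ = false) {q q' : Fin n}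
    (hq : (q : ℕ) + 1 = q') :
    (S.diagram t).follows (.over (.sat ℓ q')) (.over (.sat ℓ q)) := by
  have not_upper : S.satPos ℓ ≠ S.β.upper ℓ := of_decide_eq_false hℓ
  have ne_k : (S.β.track ℓ).symm (S.β.upper ℓ) ≠ S.k := fun e =>
    not_upper ((Equiv.symm_apply_eq _).1 e).symm
  refine isChain_iff_forall_infix.1 ((isTraversal_diagram t).isChain (.inl ⟨_, ne_k⟩)) _ _
    (.trans ?_ (outerCrossing_infix _ ℓ))
  simpa [outerCrossing, ℓ.2, (S.β.lower_ne_upper ℓ).symm] using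
    (pair_infix_reverse_finRange hq).map fun q => (.over (.sat ℓ q) : S.Pass)

theorem follows_under_diagramAfterBraid {q q' : Fin n} (hq : (q : ℕ) + 1 = q') (j : S.Strand) :
    (diagramAfterBraid t).follows (.under (.c (.inr q') j)) (.under (.c (.inr q) j)) := by
  obtain ⟨i, rfl⟩ := exitPerm.surjective j
  refine isChain_iff_forall_infix.1 ((isTraversal_diagramAfterBraid t).isChain i) _ _ ?_
  have pair := leavingPass_pair hq (S.exit i)
  rcases i with i | p
  · exact (pair.trans ⟨S.outerBraid i, _, rfl⟩).map (rename (placeEach S.γ.perm.symm 1 1))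
  · exact pair.trans ⟨S.satBraid p, S.returningPass (S.exit (.inr p)) ++ S.boxBraid (S.γ.perm p),
      by simp [wordAfterBraid, exit]⟩

theorem follows_over_diagramAfterReturning {q q' : Fin n} (hq : (q : ℕ) + 1 = q')
    (i : S.Strand) :
    (diagramAfterReturning t).follows (.over (.c i (.inr q))) (.over (.c i (.inr q'))) := by
  obtain ⟨j, rfl⟩ := exitPerm.surjective i
  refine isChain_iff_forall_infix.1 ((isTraversal_diagramAfterReturning t).isChain j) _ _ ?_
  have pair := returningPass_pair hq (S.exit j)
  rcases j with j | p
  · exact (pair.trans (List.suffix_append _ _).isInfix).map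
      (rename (placeEach S.γ.perm.symm S.γ.perm.symm 1))
  · exact pair.trans (List.suffix_append _ _).isInfix

end Adjacency

section Legality

variable {R : Type*} [CommRing R] (t : S.BasePoint → Rˣ) {x : Bool × (Fin n → S.Chord)}

theorem crossable_braidGroups (hx : x ∈ S.braidGroups) :
    Crossable (S.diagram t) x.1 x.2 1 := by
  have injective := separated_braidGroups.injective x hx
  have ne_box := separated_braidGroups.ne_box x hx
  obtain ⟨ℓ, rfl⟩ := mem_braidGroups.1 hx
  refine ⟨injective, ne_box, fun _ => rfl, fun _ => rfl, fun q q' hq => ?_, fun q q' hq ho => ?_⟩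
  · cases hℓ : S.satIsOver ℓ
    · exact follows_sat_upper t hℓ hq
    · exact follows_sat_lower t hℓ hq
  · exact if_neg (not_follows_over_sat t ho (Fin.le_def.2 (by omega)))

theorem crossable_returningGroups (hx : x ∈ S.returningGroups) :
    Crossable (diagramAfterBraid t) x.1 x.2 (-1) := by
  have injective := separated_returningGroups.injective x hx
  have ne_box := separated_returningGroups.ne_box x hx
  obtain ⟨j, rfl⟩ := mem_returningGroups.1 hx
  exact ⟨injective, ne_box, fun _ => rfl, fun _ => rfl,
    fun q q' hq => follows_under_diagramAfterBraid t hq j, by simp⟩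

theorem crossable_leavingGroups (hx : x ∈ S.leavingGroups) :
    Crossable (diagramAfterReturning t) x.1 x.2 (-1) := by
  have injective := separated_leavingGroups.injective x hx
  have ne_box := separated_leavingGroups.ne_box x hx
  obtain ⟨i, rfl⟩ := mem_leavingGroups.1 hx
  exact ⟨injective, ne_box, fun _ => rfl, fun _ => rfl,
    fun q q' hq => follows_over_diagramAfterReturning t hq i,
    fun q q' hq _ => if_pos (follows_over_diagramAfterReturning t hq i)⟩

theorem realizes_purpleLoop : (S.diagram t).Realizes (S.loopMap t) S.purpleLoop := by
  rw [purpleLoop_eq, realizes_append, realizes_append, totalExchange_append, transport_mul]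
  refine ⟨⟨?_, ?_⟩, ?_⟩
  · refine realizes_pushAll separated_braidGroups (fun x hx => ⟨_, crossable_braidGroups t hx⟩)
      fun q => ?_
    rw [← satBraid_eq]
    have word := (isTraversal_diagram t).isChain (.inr q)
    rw [strandWord, List.append_assoc] at word
    exact (List.isChain_append.1 word).1
  · refine realizes_pushAll separated_returningGroups (D := diagramAfterBraid t)
      (fun x hx => ⟨_, crossable_returningGroups t hx⟩) fun q => ?_
    obtain ⟨p, rfl⟩ := S.γ.perm.surjective q
    rw [approach_returningGroups]
    have word := (isTraversal_diagramAfterBraid t).isChain (.inr p)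
    rw [wordAfterBraid, List.append_assoc] at word
    exact (List.isChain_append.1 word).2.1
  · refine realizes_pushAll separated_leavingGroups (D := diagramAfterReturning t)
      (fun x hx => ⟨_, crossable_leavingGroups t hx⟩) fun q => ?_
    obtain ⟨p, rfl⟩ := S.γ.perm.surjective q
    rw [approach_leavingGroups]
    have word := (isTraversal_diagramAfterReturning t).isChain (.inr p)
    rw [wordAfterReturning, List.append_assoc (S.satBraid p)] at word
    exact (List.isChain_append.1 (List.isChain_append.1 word).1).2.1

end Legality

end SatelliteBraid

/-! ### The monodromy -/

section Carries

open Matrix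

variable {ι R A : Type*} [Fintype ι] [CommSemiring R] [Semiring A] [Algebra R A]

section AlgHom

variable {B : Type*} [Semiring B] [Algebra R B] (φ : A →ₐ[R] B) (M : Matrix ι ι A) (v : ι → A)

theorem algHom_comp_mulVec : φ ∘ (M *ᵥ v) = M.map φ *ᵥ (φ ∘ v) :=
  funext fun i => RingHom.map_mulVec φ.toRingHom M v i

theorem algHom_comp_vecMul : φ ∘ (v ᵥ* M) = (φ ∘ v) ᵥ* M.map φ :=
  funext fun i => RingHom.map_vecMul φ.toRingHom M v i

end AlgHom

/-- The algebra map `φ` transforms the entries of `v` into those of `M *ᵥ w` (if `o = true`), or of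
`w ᵥ* M⁻¹`. The latter is stated without an inverse of `M`. -/
def Carries : Bool → (A →ₐ[R] A) → Matrix ι ι A → (ι → A) → (ι → A) → Prop
  | true, φ, M, v, w => φ ∘ v = M *ᵥ w
  | false, φ, M, v, w => (φ ∘ v) ᵥ* M = w

variable {o : Bool} {φ ψ : A →ₐ[R] A} {M N : Matrix ι ι A} {u v w : ι → A}

theorem Carries.comp (hφ : Carries o φ M v w) (hψ : Carries o ψ N w u) (hM : M.map ψ = M) :
    Carries o (ψ.comp φ) (M * N) v u := by
  cases o with
  | true =>
    change ψ ∘ φ ∘ v = _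
    rw [show φ ∘ v = M *ᵥ w from hφ, algHom_comp_mulVec, hM, show ψ ∘ w = N *ᵥ u from hψ,
      mulVec_mulVec]
  | false =>
    change (ψ ∘ φ ∘ v) ᵥ* (M * N) = u
    have push : (ψ ∘ φ ∘ v) ᵥ* M = ψ ∘ w := by
      rw [← show (φ ∘ v) ᵥ* M = w from hφ, algHom_comp_vecMul, hM]
    rw [← vecMul_vecMul, push]
    exact hψ

theorem carries_one [DecidableEq ι] (h : ∀ i, φ (v i) = w i) : Carries o φ 1 v w := by
  cases o with
  | true => exact (funext h).trans (one_mulVec w).symm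
  | false => exact (vecMul_one _).trans (funext h)

end Carries

section Elementary

open Matrix

variable {ι A : Type*} [Fintype ι] [DecidableEq ι] [Ring A]

theorem isUnit_one_add_single {i j : ι} (h : i ≠ j) (a : A) :
    IsUnit (1 + Matrix.single i j a) :=
  IsNilpotent.isUnit_one_add ⟨2, by rw [sq, single_mul_single_of_ne a i j i h.symm a]⟩

theorem one_add_single_mulVec (i j : ι) (a : A) (v : ι → A) (k : ι) :
    ((1 + Matrix.single i j a) *ᵥ v) k = if k = i then v i + a * v j else v k := by
  rw [add_mulVec, one_mulVec, single_mulVec, Pi.add_apply, Function.update_apply]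
  split_ifs with h
  · rw [h]
  · rw [Pi.zero_apply, add_zero]

theorem vecMul_one_add_single (i j : ι) (a : A) (v : ι → A) (k : ι) :
    (v ᵥ* (1 + Matrix.single i j a)) k = if k = j then v j + v i * a else v k := by
  rw [vecMul_add, vecMul_one, Pi.add_apply]
  split_ifs with h
  · simp [h, vecMul, dotProduct, Matrix.single]
  · simp [Ne.symm h, vecMul, dotProduct, Matrix.single]

end Elementary

namespace PositiveBraid

open Matrix

variable {n : ℕ} (b : PositiveBraid n) {A : Type*} [Ring A]

theorem crossingMatrix_eq_submatrix (ℓ : Fin b.len) (a : A) :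
    b.crossingMatrix ℓ a = (1 + Matrix.single (b.upper ℓ) (b.lower ℓ) a).submatrix id
      (Equiv.swap (b.lower ℓ) (b.upper ℓ)) := by
  have hne := b.lower_ne_upper ℓ
  ext i j
  simp only [crossingMatrix, submatrix_apply, Matrix.add_apply, one_apply, single_apply, id,
    Equiv.swap_apply_def]
  grind

theorem isUnit_crossingMatrix (ℓ : Fin b.len) (a : A) : IsUnit (b.crossingMatrix ℓ a) := by
  rw [crossingMatrix_eq_submatrix]
  obtain ⟨U, hU⟩ := isUnit_one_add_single (b.lower_ne_upper ℓ).symm a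
  set σ := Equiv.swap (b.lower ℓ) (b.upper ℓ)
  have right : U.1.submatrix id σ * (U⁻¹).1.submatrix σ id = 1 := by
    rw [submatrix_mul_equiv, U.mul_inv, submatrix_id_id]
  have left : (U⁻¹).1.submatrix σ id * U.1.submatrix id σ = 1 := by
    rw [← Equiv.coe_refl, submatrix_mul_equiv, U.inv_mul, submatrix_one_equiv]
  exact hU ▸ ⟨⟨_, _, right, left⟩, rfl⟩

theorem map_crossingMatrix {B F : Type*} [Ring B] [FunLike F A B] [RingHomClass F A B] (f : F)
    (ℓ : Fin b.len) (a : A) : (b.crossingMatrix ℓ a).map f = b.crossingMatrix ℓ (f a) := by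
  ext i j
  simp only [map_apply, crossingMatrix]
  split_ifs <;> simp

end PositiveBraid

namespace SatelliteBraid

open Matrix LinkDiagram

variable {m n : ℕ} (S : SatelliteBraid m n) {R : Type*} [CommRing R] (t : S.BasePoint → Rˣ)

section PathMatrix

/-- The path matrix of the column `c` of base points of the box. -/
noncomputable def columnMatrix (c : Fin (S.γ.len + 1)) : Matrix (Fin n) (Fin n) (S.Alg R) :=
  Matrix.diagonal fun q => algebraMap R (S.Alg R) (t (.box c q))

/-- The path matrix of the crossing `ℓ` of the box and the column of base points preceding it. -/
noncomputable def letterMatrix (ℓ : Fin S.γ.len) : Matrix (Fin n) (Fin n) (S.Alg R) :=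
  S.columnMatrix t ℓ.castSucc * S.γ.crossingMatrix ℓ (FreeAlgebra.ι R (.box ℓ))

theorem boxMatrix_eq : S.boxMatrix t =
    ((List.finRange S.γ.len).map (S.letterMatrix t)).prod * S.columnMatrix t (Fin.last _) := by
  refine Eq.trans ?_ (prod_map_finRange_mul_last (S.columnMatrix t)
    fun ℓ => S.γ.crossingMatrix ℓ (FreeAlgebra.ι R (.box ℓ))).symm
  rw [← List.ofFn_eq_map]
  rfl

theorem isUnit_columnMatrix (c : Fin (S.γ.len + 1)) : IsUnit (S.columnMatrix t c) := by
  have hu : IsUnit fun q => algebraMap R (S.Alg R) (t (.box c q)) :=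
    Pi.isUnit_iff.2 fun q => (t (.box c q)).isUnit.map _
  exact hu.map (Matrix.diagonalRingHom (Fin n) (S.Alg R))

theorem isUnit_boxMatrix : IsUnit (S.boxMatrix t) := by
  have letters (M : Matrix (Fin n) (Fin n) (S.Alg R))
      (hM : M ∈ (List.finRange S.γ.len).map (S.letterMatrix t)) : IsUnit M := by
    obtain ⟨ℓ, -, rfl⟩ := List.mem_map.1 hM
    exact (S.isUnit_columnMatrix t _).mul (S.γ.isUnit_crossingMatrix _ _)
  rw [boxMatrix_eq]
  exact (List.prod_induction _ (fun _ _ => IsUnit.mul) isUnit_one letters).mul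
    (S.isUnit_columnMatrix t _)

theorem isUnit_extendedBoxMatrix : IsUnit (S.extendedBoxMatrix t) := by
  obtain ⟨U, hU⟩ := S.isUnit_boxMatrix t
  refine ⟨⟨S.extendedBoxMatrix t, .fromBlocks 1 0 0 (U⁻¹).1, ?_, ?_⟩, rfl⟩ <;>
    simp [extendedBoxMatrix, ← hU, Matrix.fromBlocks_multiply]

variable {S t} {φ : S.Alg R →ₐ[R] S.Alg R}

theorem map_columnMatrix (φ : S.Alg R →ₐ[R] S.Alg R) (c : Fin (S.γ.len + 1)) :
    (S.columnMatrix t c).map φ = S.columnMatrix t c := by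
  rw [columnMatrix, diagonal_map (map_zero φ)]
  exact congrArg _ (funext fun q => φ.commutes _)

theorem map_prod_letterMatrix (hφ : ∀ ℓ, φ (FreeAlgebra.ι R (.box ℓ)) = FreeAlgebra.ι R (.box ℓ))
    (L : List (Fin S.γ.len)) :
    (L.map (S.letterMatrix t)).prod.map φ = (L.map (S.letterMatrix t)).prod := by
  have letter (ℓ : Fin S.γ.len) : φ.mapMatrix (S.letterMatrix t ℓ) = S.letterMatrix t ℓ := by
    rw [letterMatrix, map_mul, AlgHom.mapMatrix_apply, AlgHom.mapMatrix_apply, map_columnMatrix,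
      PositiveBraid.map_crossingMatrix, hφ]
  rw [← AlgHom.mapMatrix_apply, map_list_prod, List.map_map]
  exact congrArg List.prod (List.map_congr_left fun ℓ _ => letter ℓ)

theorem map_boxMatrix (hφ : ∀ ℓ, φ (FreeAlgebra.ι R (.box ℓ)) = FreeAlgebra.ι R (.box ℓ)) :
    (S.boxMatrix t).map φ = S.boxMatrix t := by
  rw [boxMatrix_eq, Matrix.map_mul, map_columnMatrix, map_prod_letterMatrix hφ]

theorem map_extendedBoxMatrix
    (hφ : ∀ ℓ, φ (FreeAlgebra.ι R (.box ℓ)) = FreeAlgebra.ι R (.box ℓ)) :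
    (S.extendedBoxMatrix t).map φ = S.extendedBoxMatrix t := by
  rw [extendedBoxMatrix, fromBlocks_map, map_boxMatrix hφ,
    Matrix.map_one _ (map_zero φ) (map_one φ), Matrix.map_zero _ (map_zero φ),
    Matrix.map_zero _ (map_zero φ)]

end PathMatrix

section PushBox

variable {S t} {o : Bool} {h : Fin n → S.Chord} {x : S.Chord}

theorem loopMap_pushColumn_of_ne (hx : ∀ q, x ≠ h q) (c : Fin (S.γ.len + 1)) :
    ∀ s ∈ S.pushColumn o h c, S.loopMap t s (FreeAlgebra.ι R x) = FreeAlgebra.ι R x := by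
  intro s hs
  obtain ⟨p, -, rfl⟩ := List.mem_map.1 hs
  exact substitution_ι_of_ne (hx _) _

theorem loopMap_pushCrossing_of_ne (hx : ∀ q, x ≠ h q) (ℓ : Fin S.γ.len) :
    S.loopMap t (S.pushCrossing o h ℓ) (FreeAlgebra.ι R x) = FreeAlgebra.ι R x := by
  cases o <;> exact substitution_ι_of_ne (hx _) _

theorem composite_pushBox_of_ne (hx : ∀ q, x ≠ h q) :
    composite (S.loopMap t) (S.pushBox o h) (FreeAlgebra.ι R x) = FreeAlgebra.ι R x := by
  refine composite_apply_of_forall_fixed fun s hs => ?_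
  simp only [pushBox_eq, List.mem_append, List.mem_flatMap, List.mem_singleton] at hs
  rcases hs with ⟨ℓ, -, hs | rfl⟩ | hs
  · exact loopMap_pushColumn_of_ne hx _ s hs
  · exact loopMap_pushCrossing_of_ne hx ℓ
  · exact loopMap_pushColumn_of_ne hx _ s hs

theorem composite_pushColumn_ι (hh : h.Injective) (c : Fin (S.γ.len + 1)) (p : Fin n) :
    composite (S.loopMap t) (S.pushColumn o h c) (FreeAlgebra.ι R (S.crossingAt h c p)) =
      ((if o then t (.box c p) else (t (.box c p))⁻¹ : Rˣ) : R) •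
        FreeAlgebra.ι R (S.crossingAt h c p) := by
  obtain ⟨L₁, L₂, hL⟩ := List.append_of_mem (List.mem_finRange p)
  have hp := hL ▸ List.nodup_finRange n
  rw [List.nodup_middle, List.nodup_cons, List.mem_append, not_or] at hp
  have fixed (L : List (Fin n)) (hpL : p ∉ L) : composite (S.loopMap t)
      (L.map fun p' => .slide (.box c p') (S.crossingAt h c p') o true)
      (FreeAlgebra.ι R (S.crossingAt h c p)) = FreeAlgebra.ι R (S.crossingAt h c p) := by
    refine composite_apply_of_forall_fixed fun s hs => ?_
    obtain ⟨p', hp', rfl⟩ := List.mem_map.1 hs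
    exact substitution_ι_of_ne
      (fun e => hpL (by rwa [(S.γ.track c).symm.injective (hh e)])) _
  rw [pushColumn, hL, List.map_append, List.map_cons, composite_append, AlgHom.comp_apply,
    fixed _ hp.1.1, composite, AlgHom.comp_apply, loopMap, substitution_ι_self, map_smul,
    fixed _ hp.1.2]

theorem carries_pushColumn (hh : h.Injective) (c : Fin (S.γ.len + 1)) :
    Carries o (composite (S.loopMap t) (S.pushColumn o h c)) (S.columnMatrix t c)
      (FreeAlgebra.ι R ∘ S.crossingAt h c) (FreeAlgebra.ι R ∘ S.crossingAt h c) := by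
  cases o with
  | true =>
    funext p
    rw [columnMatrix, mulVec_diagonal, Function.comp_apply, Function.comp_apply,
      composite_pushColumn_ι hh, Algebra.smul_def, if_pos rfl]
  | false =>
    funext p
    rw [columnMatrix, vecMul_diagonal, Function.comp_apply, Function.comp_apply,
      composite_pushColumn_ι hh, ← Algebra.commutes, ← Algebra.smul_def, smul_smul,
      if_neg Bool.false_ne_true, Units.mul_inv, one_smul]

theorem carries_pushCrossing (hh : h.Injective) (hbox : ∀ q ℓ, h q ≠ .box ℓ) (ℓ : Fin S.γ.len) :
    Carries o (S.loopMap t (S.pushCrossing o h ℓ))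
      (S.γ.crossingMatrix ℓ (FreeAlgebra.ι R (.box ℓ)))
      (FreeAlgebra.ι R ∘ S.crossingAt h ℓ.castSucc) (FreeAlgebra.ι R ∘ S.crossingAt h ℓ.succ) := by
  have ne_of_ne {p p' : Fin n} (hp : p ≠ p') :
      S.crossingAt h ℓ.castSucc p ≠ S.crossingAt h ℓ.castSucc p' :=
    fun e => hp ((S.γ.track _).symm.injective (hh e))
  rw [show S.crossingAt h ℓ.succ = S.crossingAt h ℓ.castSucc ∘ _ from
    funext (crossingAt_succ ℓ), PositiveBraid.crossingMatrix_eq_submatrix]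
  cases o with
  | true =>
    funext p
    change S.loopMap t (.triple _ _ _) _ = (Matrix.submatrix _ _ _ *ᵥ _) p
    rw [submatrix_mulVec_equiv, Function.comp_id, one_add_single_mulVec, loopMap_triple_box]
    simp only [Function.comp_apply, Equiv.apply_symm_apply]
    split_ifs with hp
    · rw [hp, substitution_ι_self]
    · exact substitution_ι_of_ne (ne_of_ne hp) _
  | false =>
    change _ ᵥ* Matrix.submatrix _ (Equiv.refl _) _ = _
    rw [submatrix_vecMul_equiv, Equiv.refl_symm, Equiv.coe_refl, Function.comp_id]
    refine funext fun p => (vecMul_one_add_single _ _ _ _ _).trans ?_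
    simp only [Function.comp_apply]
    generalize Equiv.swap (S.γ.lower ℓ) (S.γ.upper ℓ) p = p
    change (if _ then S.loopMap t (.triple _ _ _) _ + S.loopMap t (.triple _ _ _) _ * _
      else S.loopMap t (.triple _ _ _) _) = _
    rw [loopMap_triple_of_ne (x := S.crossingAt h _ _) _ (hbox _)]
    split_ifs with hp
    · rw [hp, substitution_ι_self,
        substitution_ι_of_ne (ne_of_ne (S.γ.lower_ne_upper ℓ).symm), sub_add_cancel]
    · exact substitution_ι_of_ne (ne_of_ne hp) _

theorem carries_pushLetters_append {L : List (Fin S.γ.len)} {ℓ : Fin S.γ.len}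
    (hh : h.Injective) (hbox : ∀ q ℓ, h q ≠ .box ℓ)
    (hL : Carries o (composite (S.loopMap t) (S.pushLetters o h L))
      (L.map (S.letterMatrix t)).prod (FreeAlgebra.ι R ∘ h)
      (FreeAlgebra.ι R ∘ S.crossingAt h ℓ.castSucc)) :
    Carries o (composite (S.loopMap t) (S.pushLetters o h (L ++ [ℓ])))
      ((L ++ [ℓ]).map (S.letterMatrix t)).prod (FreeAlgebra.ι R ∘ h)
      (FreeAlgebra.ι R ∘ S.crossingAt h ℓ.succ) := by
  have box_ne (ℓ : Fin S.γ.len) (q : Fin n) : .box ℓ ≠ h q := (hbox q ℓ).symm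
  have column_fixes (ℓ' : Fin S.γ.len) : composite (S.loopMap t)
      (S.pushColumn o h ℓ.castSucc) (FreeAlgebra.ι R (.box ℓ')) = FreeAlgebra.ι R (.box ℓ') :=
    composite_apply_of_forall_fixed (loopMap_pushColumn_of_ne (box_ne ℓ') _)
  have hcolumn := hL.comp (carries_pushColumn hh ℓ.castSucc) (map_prod_letterMatrix column_fixes L)
  have hcrossing := hcolumn.comp (carries_pushCrossing hh hbox ℓ) <| by
    rw [Matrix.map_mul, map_columnMatrix,
      map_prod_letterMatrix fun ℓ' => loopMap_pushCrossing_of_ne (t := t) (box_ne ℓ') ℓ]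
  rw [pushLetters, List.flatMap_append, List.flatMap_singleton, composite_append,
    composite_append, List.map_append, List.map_singleton, List.prod_append, List.prod_singleton,
    letterMatrix, ← mul_assoc]
  exact hcrossing

theorem carries_pushBox (hh : h.Injective) (hbox : ∀ q ℓ, h q ≠ .box ℓ) :
    Carries o (composite (S.loopMap t) (S.pushBox o h)) (S.boxMatrix t) (FreeAlgebra.ι R ∘ h)
      (FreeAlgebra.ι R ∘ h ∘ S.γ.perm.symm) := by
  have letters : Carries o (composite (S.loopMap t) (S.pushLetters o h (List.finRange S.γ.len)))
      ((List.finRange S.γ.len).map (S.letterMatrix t)).prod (FreeAlgebra.ι R ∘ h)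
      (FreeAlgebra.ι R ∘ S.crossingAt h (Fin.last _)) :=
    finRange_split_induction (motive := fun c L _ =>
      Carries o (composite (S.loopMap t) (S.pushLetters o h L)) (L.map (S.letterMatrix t)).prod
        (FreeAlgebra.ι R ∘ h) (FreeAlgebra.ι R ∘ S.crossingAt h c))
      (carries_one fun _ => rfl)
      fun _ _ _ _ hL => carries_pushLetters_append hh hbox hL
  rw [pushBox_eq, composite_append, boxMatrix_eq]
  exact letters.comp (carries_pushColumn hh _) (map_prod_letterMatrix (fun ℓ =>
    composite_apply_of_forall_fixed (loopMap_pushColumn_of_ne (fun q => (hbox q ℓ).symm) _)) _)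

end PushBox

section PushAll

variable {S t} {H : List (Bool × (Fin n → S.Chord))}

theorem composite_pushAll_of_ne {x : S.Chord} (hx : ∀ y ∈ H, ∀ q, x ≠ y.2 q) :
    composite (S.loopMap t) (pushAll H) (FreeAlgebra.ι R x) = FreeAlgebra.ι R x := by
  induction H with
  | nil => rfl
  | cons y H ih =>
    rw [pushAll, List.flatMap_cons, composite_append, AlgHom.comp_apply,
      composite_pushBox_of_ne (hx y (by simp))]
    exact ih fun z hz => hx z (by simp [hz])

theorem Separated.composite_pushAll_box (hH : Separated H) (ℓ : Fin S.γ.len) :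
    composite (S.loopMap t) (pushAll H) (FreeAlgebra.ι R (.box ℓ)) = FreeAlgebra.ι R (.box ℓ) :=
  composite_pushAll_of_ne fun y hy q => (hH.ne_box y hy q ℓ).symm

theorem Separated.carries_pushAll (hH : Separated H) {x : Bool × (Fin n → S.Chord)}
    (hx : x ∈ H) :
    Carries x.1 (composite (S.loopMap t) (pushAll H)) (S.boxMatrix t) (FreeAlgebra.ι R ∘ x.2)
      (FreeAlgebra.ι R ∘ x.2 ∘ S.γ.perm.symm) := by
  induction H with
  | nil => simp at hx
  | cons y H ih =>
    have hy := List.pairwise_cons.1 hH.pairwise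
    rw [pushAll, List.flatMap_cons, composite_append, ← pushAll]
    rcases List.mem_cons.1 hx with rfl | hx
    · have tail_fixes (q : Fin n) : composite (S.loopMap t) (pushAll H)
          (FreeAlgebra.ι R (x.2 q)) = FreeAlgebra.ι R (x.2 q) :=
        composite_pushAll_of_ne fun z hz q' => hy.1 z hz q q'
      rw [← mul_one (S.boxMatrix t)]
      exact (carries_pushBox (hH.injective x (by simp)) (hH.ne_box x (by simp))).comp
        (carries_one fun q => tail_fixes _) (map_boxMatrix hH.tail.composite_pushAll_box)
    · have head_fixes (q : Fin n) : composite (S.loopMap t) (S.pushBox y.1 y.2)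
          (FreeAlgebra.ι R (x.2 q)) = FreeAlgebra.ι R (x.2 q) :=
        composite_pushBox_of_ne fun q' => (hy.1 x hx q' q).symm
      have head : Carries x.1 (composite (S.loopMap t) (S.pushBox y.1 y.2)) 1
          (FreeAlgebra.ι R ∘ x.2) (FreeAlgebra.ι R ∘ x.2) := carries_one head_fixes
      rw [← one_mul (S.boxMatrix t)]
      exact head.comp (ih hH.tail hx) (Matrix.map_one _ (map_zero _) (map_one _))

end PushAll

end SatelliteBraid

section Blocks

open Matrix

variable {ι κ R A : Type*} [Fintype ι] [Fintype κ] [CommSemiring R] [Semiring A] [Algebra R A]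
  {o : Bool} {φ : A →ₐ[R] A}

theorem Carries.fromBlocks {M : Matrix ι ι A} {v w : ι → A} {N : Matrix κ κ A} {v' w' : κ → A}
    (h : Carries o φ M v w) (h' : Carries o φ N v' w') :
    Carries o φ (.fromBlocks M 0 0 N) (Sum.elim v v') (Sum.elim w w') := by
  cases o with
  | true =>
    refine (Sum.comp_elim φ v v').trans ?_
    rw [fromBlocks_mulVec, show φ ∘ v = M *ᵥ w from h, show φ ∘ v' = N *ᵥ w' from h']
    simp
  | false =>
    refine (congrArg (· ᵥ* _) (Sum.comp_elim φ v v')).trans ?_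
    rw [vecMul_fromBlocks]
    simpa using congrArg₂ Sum.elim (show (φ ∘ v) ᵥ* M = w from h) h'

end Blocks

namespace SatelliteBraid

open Matrix LinkDiagram

variable {m n : ℕ} {S : SatelliteBraid m n} {R : Type*} [CommRing R] {t : S.BasePoint → Rˣ}

/-- The algebra map of the identification of the chords at the end of the loop. -/
noncomputable def identificationMap (S : SatelliteBraid m n) (R : Type*) [CommRing R] :
    S.Alg R →ₐ[R] S.Alg R :=
  FreeAlgebra.lift R fun x => FreeAlgebra.ι R (S.identification x)

theorem identificationMap_ι (x : S.Chord) :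
    S.identificationMap R (FreeAlgebra.ι R x) = FreeAlgebra.ι R (S.place S.γ.perm x) :=
  FreeAlgebra.lift_ι_apply _ _

theorem monodromy_eq : S.monodromy t = (S.identificationMap R).comp
    ((composite (S.loopMap t) (pushAll S.leavingGroups)).comp
      ((composite (S.loopMap t) (pushAll S.returningGroups)).comp
        (composite (S.loopMap t) (pushAll S.braidGroups)))) := by
  rw [monodromy, (S.realizes_purpleLoop t).inducedMap_eq, purpleLoop_eq, composite_append,
    composite_append]
  rfl

section Fixed

variable {x : S.Chord}

theorem composite_braidGroups_of_ne (hx : ∀ ℓ q, x ≠ .sat ℓ q) :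
    composite (S.loopMap t) (pushAll S.braidGroups) (FreeAlgebra.ι R x) = FreeAlgebra.ι R x :=
  composite_pushAll_of_ne fun y hy q => by
    obtain ⟨ℓ, rfl⟩ := mem_braidGroups.1 hy
    exact hx ℓ q

theorem composite_returningGroups_of_ne (hx : ∀ q j, x ≠ .c (.inr q) j) :
    composite (S.loopMap t) (pushAll S.returningGroups) (FreeAlgebra.ι R x) = FreeAlgebra.ι R x :=
  composite_pushAll_of_ne fun y hy q => by
    obtain ⟨j, rfl⟩ := mem_returningGroups.1 hy
    exact hx q j

theorem composite_leavingGroups_of_ne (hx : ∀ i q, x ≠ .c i (.inr q)) :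
    composite (S.loopMap t) (pushAll S.leavingGroups) (FreeAlgebra.ι R x) = FreeAlgebra.ι R x :=
  composite_pushAll_of_ne fun y hy q => by
    obtain ⟨i, rfl⟩ := mem_leavingGroups.1 hy
    exact hx i q

theorem monodromy_ι_of_ne (hsat : ∀ ℓ q, x ≠ .sat ℓ q) (hrow : ∀ q j, x ≠ .c (.inr q) j)
    (hcol : ∀ i q, x ≠ .c i (.inr q)) :
    S.monodromy t (FreeAlgebra.ι R x) = FreeAlgebra.ι R (S.place S.γ.perm x) := by
  simp only [monodromy_eq, AlgHom.comp_apply, composite_braidGroups_of_ne hsat,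
    composite_returningGroups_of_ne hrow, composite_leavingGroups_of_ne hcol, identificationMap_ι]

theorem monodromy_outer (ℓ : {ℓ // ¬ S.IsSat ℓ}) :
    S.monodromy t (FreeAlgebra.ι R (.outer ℓ)) = FreeAlgebra.ι R (.outer ℓ) :=
  monodromy_ι_of_ne (by simp) (by simp) (by simp)

theorem monodromy_box (ℓ : Fin S.γ.len) :
    S.monodromy t (FreeAlgebra.ι R (.box ℓ)) = FreeAlgebra.ι R (.box ℓ) :=
  monodromy_ι_of_ne (by simp) (by simp) (by simp)

theorem monodromy_c_inl (i j : {i // i ≠ S.k}) :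
    S.monodromy t (FreeAlgebra.ι R (.c (.inl i) (.inl j))) =
      FreeAlgebra.ι R (.c (.inl i) (.inl j)) :=
  monodromy_ι_of_ne (by simp) (by simp) (by simp)

end Fixed

section Groups

variable {ℓ : {ℓ // S.IsSat ℓ}}

theorem carries_monodromy_group (ℓ : {ℓ // S.IsSat ℓ}) :
    Carries (S.satIsOver ℓ) (S.monodromy t) (S.boxMatrix t) (S.group R ℓ) (S.group R ℓ) := by
  obtain ⟨grid, hgrid⟩ : ∃ φ, φ = (S.identificationMap R).comp
    ((composite (S.loopMap t) (pushAll S.leavingGroups)).comp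
      (composite (S.loopMap t) (pushAll S.returningGroups))) := ⟨_, rfl⟩
  have grid_ι {x : S.Chord} (hx : ∀ i j, x ≠ .c i j) :
      grid (FreeAlgebra.ι R x) = FreeAlgebra.ι R (S.place S.γ.perm x) := by
    rw [hgrid, AlgHom.comp_apply, AlgHom.comp_apply,
      composite_returningGroups_of_ne fun _ _ => hx _ _,
      composite_leavingGroups_of_ne fun _ _ => hx _ _, identificationMap_ι]
  have grid_group (q : Fin n) :
      grid (FreeAlgebra.ι R (.sat ℓ (S.γ.perm.symm q))) = FreeAlgebra.ι R (.sat ℓ q) := by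
    rw [grid_ι (by simp)]
    exact congrArg (fun p => FreeAlgebra.ι R (Chord.sat ℓ p)) (S.γ.perm.apply_symm_apply q)
  rw [← mul_one (S.boxMatrix t), monodromy_eq, ← AlgHom.comp_assoc, ← AlgHom.comp_assoc,
    AlgHom.comp_assoc (S.identificationMap R), ← hgrid]
  exact (separated_braidGroups.carries_pushAll (mem_braidGroups.2 ⟨ℓ, rfl⟩)).comp
    (carries_one grid_group) (map_boxMatrix fun ℓ' => grid_ι (by simp))

theorem monodromy_group_over (hℓ : S.satPos ℓ = S.β.upper ℓ) :
    (fun q => S.monodromy t (S.group R ℓ q)) = S.boxMatrix t *ᵥ S.group R ℓ := by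
  have h := carries_monodromy_group (t := t) ℓ
  rwa [satIsOver, decide_eq_true hℓ] at h

theorem monodromy_group_under_vecMul (hℓ : S.satPos ℓ = S.β.lower ℓ) :
    (S.monodromy t ∘ S.group R ℓ) ᵥ* S.boxMatrix t = S.group R ℓ := by
  have h := carries_monodromy_group (t := t) ℓ
  rwa [satIsOver, decide_eq_false fun e => S.β.lower_ne_upper ℓ (hℓ.symm.trans e)] at h

theorem monodromy_group_under (hℓ : S.satPos ℓ = S.β.lower ℓ) :
    (fun q => S.monodromy t (S.group R ℓ q)) =
      S.group R ℓ ᵥ* Ring.inverse (S.boxMatrix t) := by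
  conv_rhs => rw [← monodromy_group_under_vecMul (t := t) hℓ]
  rw [vecMul_vecMul, Ring.mul_inverse_cancel _ (S.isUnit_boxMatrix t), vecMul_one]
  rfl

variable {K : Type*} [CommRing K] [Algebra R K] (f : S.Alg R →ₐ[R] K)

theorem isUnit_transpose_map_boxMatrix : IsUnit ((S.boxMatrix t).map f)ᵀ :=
  (isUnit_transpose _).2 ((S.isUnit_boxMatrix t).map f.mapMatrix)

theorem algHom_monodromy_group_under (hℓ : S.satPos ℓ = S.β.lower ℓ) :
    (fun q => f (S.monodromy t (S.group R ℓ q))) =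
      (((S.boxMatrix t).map f)ᵀ)⁻¹ *ᵥ fun q => f (S.group R ℓ q) := by
  have transformed : ((S.boxMatrix t).map f)ᵀ *ᵥ (f ∘ S.monodromy t ∘ S.group R ℓ) =
      f ∘ S.group R ℓ := by
    rw [mulVec_transpose, ← algHom_comp_vecMul, monodromy_group_under_vecMul hℓ]
  have invertible := (isUnit_iff_isUnit_det _).1 (isUnit_transpose_map_boxMatrix (t := t) f)
  change _ = _ *ᵥ (f ∘ S.group R ℓ)
  rw [← transformed, mulVec_mulVec, nonsing_inv_mul _ invertible, one_mulVec]
  rfl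

end Groups

section ChordMatrix

theorem carries_returningGroups (j : S.Strand) :
    Carries true (composite (S.loopMap t) (pushAll S.returningGroups)) (S.extendedBoxMatrix t)
      (fun i => FreeAlgebra.ι R (.c i j))
      fun i => FreeAlgebra.ι R (.c (i.map id S.γ.perm.symm) j) := by
  have h := (carries_one (o := true) (φ := composite (S.loopMap t) (pushAll S.returningGroups))
    fun i : {i // i ≠ S.k} => composite_returningGroups_of_ne (x := .c (.inl i) j) (by simp)
    ).fromBlocks (separated_returningGroups.carries_pushAll (mem_returningGroups.2 ⟨j, rfl⟩))
  convert h using 1 <;> ext (_ | _) <;> rfl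

theorem carries_leavingGroups (i : S.Strand) :
    Carries false (composite (S.loopMap t) (pushAll S.leavingGroups)) (S.extendedBoxMatrix t)
      (fun j => FreeAlgebra.ι R (.c i j))
      fun j => FreeAlgebra.ι R (.c i (j.map id S.γ.perm.symm)) := by
  have h := (carries_one (o := false) (φ := composite (S.loopMap t) (pushAll S.leavingGroups))
    fun j : {i // i ≠ S.k} => composite_leavingGroups_of_ne (x := .c i (.inl j)) (by simp)
    ).fromBlocks (separated_leavingGroups.carries_pushAll (mem_leavingGroups.2 ⟨i, rfl⟩))
  convert h using 1 <;> ext (_ | _) <;> rfl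

theorem map_monodromy_chordMatrix_mul :
    (S.chordMatrix R).map (S.monodromy t) * S.extendedBoxMatrix t =
      S.extendedBoxMatrix t * S.chordMatrix R := by
  set P := S.extendedBoxMatrix t
  set C := S.chordMatrix R
  set σ : S.Strand → S.Strand := Sum.map id S.γ.perm.symm
  set Ψ := composite (S.loopMap t) (pushAll S.leavingGroups)
  have braid : C.map (composite (S.loopMap t) (pushAll S.braidGroups)) = C :=
    Matrix.ext fun i j => composite_braidGroups_of_ne (by simp)
  have returning : C.map (composite (S.loopMap t) (pushAll S.returningGroups)) =
      P * C.submatrix σ id :=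
    Matrix.ext fun i j => congrFun (carries_returningGroups j) i
  have leaving : (C.submatrix σ id).map Ψ * P = C.submatrix σ σ :=
    Matrix.ext fun i j => congrFun (carries_leavingGroups (σ i)) j
  have identified : (C.submatrix σ σ).map (S.identificationMap R) = C :=
    Matrix.ext fun i j => (identificationMap_ι _).trans <| by
      rcases i with i | i <;> rcases j with j | j <;> simp [σ, place, C, chordMatrix]
  have leaving_P : P.map Ψ = P :=
    map_extendedBoxMatrix separated_leavingGroups.composite_pushAll_box
  have identified_P : P.map (S.identificationMap R) = P :=
    map_extendedBoxMatrix fun ℓ => identificationMap_ι _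
  calc C.map (S.monodromy t) * P
      = ((P * C.submatrix σ id).map Ψ).map (S.identificationMap R) * P := by
        rw [monodromy_eq, ← returning]
        conv_rhs => rw [← braid]
        rfl
    _ = ((P * C.submatrix σ id).map Ψ * P).map (S.identificationMap R) := by
        rw [Matrix.map_mul (f := S.identificationMap R), identified_P]
    _ = (P * C.submatrix σ σ).map (S.identificationMap R) := by
        rw [Matrix.map_mul (f := Ψ), leaving_P, mul_assoc, leaving]
    _ = P * C := by rw [Matrix.map_mul, identified_P, identified]

theorem map_monodromy_chordMatrix :
    (S.chordMatrix R).map (S.monodromy t) =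
      S.extendedBoxMatrix t * S.chordMatrix R * Ring.inverse (S.extendedBoxMatrix t) := by
  rw [← map_monodromy_chordMatrix_mul, mul_assoc,
    Ring.mul_inverse_cancel _ (S.isUnit_extendedBoxMatrix t), mul_one]

end ChordMatrix

end SatelliteBraid

theorem proposition5p2 {R : Type*} [CommRing R] {m n : ℕ} (S : SatelliteBraid m n)
    (t : S.BasePoint → Rˣ) :
    -- the purple-box loop is a loop of legal Reidemeister III and base point moves
    ((S.diagram t).Legal S.purpleLoop ∧
      ((S.diagram t).run S.purpleLoop).relabel S.identification = S.diagram t) ∧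
    -- degree 1 chords
    (IsUnit (S.extendedBoxMatrix t) ∧
      (S.chordMatrix R).map (S.monodromy t) =
        S.extendedBoxMatrix t * S.chordMatrix R * Ring.inverse (S.extendedBoxMatrix t)) ∧
    -- non-satellite crossings and the crossings in the box are fixed
    (∀ ℓ, S.monodromy t (FreeAlgebra.ι R (.outer ℓ)) = FreeAlgebra.ι R (.outer ℓ)) ∧
    (∀ i j, S.monodromy t (FreeAlgebra.ι R (.c (.inl i) (.inl j))) =
      FreeAlgebra.ι R (.c (.inl i) (.inl j))) ∧
    (∀ ℓ, S.monodromy t (FreeAlgebra.ι R (.box ℓ)) = FreeAlgebra.ι R (.box ℓ)) ∧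
    -- groups of satellite crossings where the satellited strand is the overcrossing
    (∀ ℓ, S.satPos ℓ.1 = S.β.upper ℓ.1 →
      (fun q => S.monodromy t (S.group R ℓ q)) = (S.boxMatrix t).mulVec (S.group R ℓ)) ∧
    -- groups of satellite crossings where the satellited strand is the undercrossing:
    -- as row vectors over the tensor algebra ...
    (IsUnit (S.boxMatrix t) ∧ ∀ ℓ, S.satPos ℓ.1 = S.β.lower ℓ.1 →
      (fun q => S.monodromy t (S.group R ℓ q)) =
        Matrix.vecMul (S.group R ℓ) (Ring.inverse (S.boxMatrix t))) ∧
    -- ... and, equivalently up to the order of factors, as column vectors over every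
    -- commutative algebra under the tensor algebra
    (∀ {K : Type*} [CommRing K] [Algebra R K] (f : S.Alg R →ₐ[R] K),
      IsUnit ((S.boxMatrix t).map f).transpose ∧
      ∀ ℓ, S.satPos ℓ.1 = S.β.lower ℓ.1 →
        (fun q => f (S.monodromy t (S.group R ℓ q))) =
          (((S.boxMatrix t).map f).transpose)⁻¹.mulVec (fun q => f (S.group R ℓ q))) := by
  exact ⟨⟨(SatelliteBraid.realizes_purpleLoop t).legal, S.relabel_run_purpleLoop t⟩,
    ⟨S.isUnit_extendedBoxMatrix t, SatelliteBraid.map_monodromy_chordMatrix⟩,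
    SatelliteBraid.monodromy_outer, SatelliteBraid.monodromy_c_inl, SatelliteBraid.monodromy_box,
    fun _ => SatelliteBraid.monodromy_group_over,
    ⟨S.isUnit_boxMatrix t, fun _ => SatelliteBraid.monodromy_group_under⟩,
    fun f => ⟨SatelliteBraid.isUnit_transpose_map_boxMatrix f,
      fun _ => SatelliteBraid.algHom_monodromy_group_under f⟩⟩
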